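/- **Definitions.** Let $\lambda\in\mathbb R$ and $m>0$. A $(\lambda,n+m)$-Einstein manifold without boundary is a complete Riemannian manifold $(M^n,g)$ with a smooth function $w>0$ satisfying $\mathrm{Hess}\,w=\frac{w}{m}(\mathrm{Ric}-\lambda g)$ (and, when $m=1$, also $\Delta w=-\lambda w$). Its constant $\mu$ is the value of the constant function $w\Delta w+(m-1)|\nabla w|^2+\lambda w^2$. A Riemannian manifold is Einstein if $\mathrm{Ric}=cg$ for a constant $c$. The manifold $(M,g,w)$ is rigid if $(M,g)$ is Einstein or its universal cover is isometric to a Riemannian product of Einstein manifolds. **Theorem.** Let $m>0$ be real and let $\alpha,\beta\in\mathbb R$ with $\beta\neq0$ and $(\alpha-1)^2+\beta^2\neq1$. Put $\lambda=-2(2-2\alpha+\alpha^2+\beta^2)$. Then $\lambda<-2$ and $\frac{-4}{\lambda(m+2)+4}>0$. Let $z$ be either of the two real numbers with $z^2=\frac{-4}{\lambda(m+2)+4}$, put $$A=\begin{pmatrix}\alpha&\beta\\ \beta&2-\alpha\end{pmatrix},\qquad F=\begin{pmatrix}-z(2-3\alpha+\alpha^2+\beta^2)&z\beta\\ z\beta&-z(-\alpha+\alpha^2+\beta^2)\end{pmatrix}$$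 (these matrices commute), and let $G=\mathbb R^2\ltimes\mathbb R^2$ be the $4$-dimensional Lie group in which $(s,t)\in\mathbb R^2$ acts on $\mathbb R^2$ by $\exp(sF+tA)$. Then $G$ is simply connected, solvable and non-unimodular, and the left-invariant vector fields $X_0,X_1,X_2,X_3$ that equal the coordinate vectors at the identity satisfy $[X_0,X_1]=[X_2,X_3]=0$ and $$[X_0,X_2]=F_{22}X_2+F_{23}X_3,\quad [X_0,X_3]=F_{32}X_2+F_{33}X_3,\quad [X_1,X_2]=\alpha X_2+\beta X_3,\quad [X_1,X_3]=\beta X_2+(2-\alpha)X_3,$$ where the rows and columns of $F$ are numbered $2,3$. The left-invariant Riemannian metric $g$ on $G$ for which $X_0,X_1,X_2,X_3$ is an orthonormal frame has constant scalar curvature, and there is a function $w$ on $G$ such that $(G,g,w)$ is a $(\lambda,4+m)$-Einstein manifold with $\mu=0$. This structure is not rigid. (Hence the theorem that a $(\lambda,3+m)$-Einstein manifold with $m>1$ and constant scalar curvature is rigid does not extend to dimension $4$.) -/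

import Mathlib

open scoped Manifold ContDiff Topology Matrix ENNReal

noncomputable section

/-! ### Riemannian geometry in a chart

Here `h` is a Riemannian metric on an open subset of a finite-dimensional vector space `E`, extended
arbitrarily to the whole of `E`, and `y` is a point of that subset. -/

namespace Coord

variable {E : Type} [NormedAddCommGroup E] [NormedSpace ℝ E] [FiniteDimensional ℝ E]

/-- The vector dual to a covector `ξ` with respect to the inner product `G`. -/
def sharp (G : E →L[ℝ] E →L[ℝ] ℝ) (ξ : E →L[ℝ] ℝ) : E := G.inverse ξ

/-- The Christoffel symbols of the Levi-Civita connection as a bilinear map: `Γ(u, v)` is the vector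
with `h(Γ(u, v), w) = (D_u h(v, w) + D_v h(u, w) - D_w h(u, v)) / 2` for all `w`. -/
def christoffel (h : E → E →L[ℝ] E →L[ℝ] ℝ) (y u v : E) : E :=
  let D : E →L[ℝ] E →L[ℝ] E →L[ℝ] ℝ := fderiv ℝ h y
  sharp (h y) ((1 / 2 : ℝ) • (D u v + D v u - (D.flip u).flip v))

/-- The Riemann curvature `R(u, v)w = ∇_u ∇_v w - ∇_v ∇_u w` (for constant vector fields
`u, v, w`). -/
def riemann (h : E → E →L[ℝ] E →L[ℝ] ℝ) (y u v w : E) : E :=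
  fderiv ℝ (fun y' => christoffel h y' v w) y u - fderiv ℝ (fun y' => christoffel h y' u w) y v
    + christoffel h y u (christoffel h y v w) - christoffel h y v (christoffel h y u w)

/-- The Ricci curvature `Ric(u, v) = tr (w ↦ R(w, u)v)`. -/
def ricci (h : E → E →L[ℝ] E →L[ℝ] ℝ) (y u v : E) : ℝ :=
  let b := Module.finBasis ℝ E
  ∑ i, b.coord i (riemann h y (b i) u v)

/-- The Hessian `Hess f (u, v) = u(v f) - (∇_u v) f` (for constant vector fields `u, v`). -/
def hess (h : E → E →L[ℝ] E →L[ℝ] ℝ) (f : E → ℝ) (y u v : E) : ℝ :=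
  fderiv ℝ (fun y' => fderiv ℝ f y' v) y u - fderiv ℝ f y (christoffel h y u v)

/-- The trace `∑ G^{ij} B(e_i, e_j)` of a bilinear form `B` with respect to the inner product `G`,
written as `∑ B(e_i, e^i)`, where `e^i` is the basis dual to `e_i` with respect to `G`. -/
def metricTrace (G : E →L[ℝ] E →L[ℝ] ℝ) (B : E → E → ℝ) : ℝ :=
  let b := Module.finBasis ℝ E
  ∑ i, B (b i) (sharp G (LinearMap.toContinuousLinearMap (b.coord i)))

end Coord

/-! ### Riemannian manifolds -/

/-- A smooth, finite-dimensional Riemannian manifold without boundary (Hausdorff and second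
countable), modelled on the vector space `E`. -/
structure RiemMfd where
  /-- The underlying set. -/
  carrier : Type
  /-- The model vector space. -/
  E : Type
  [normedAddCommGroup : NormedAddCommGroup E]
  [normedSpace : NormedSpace ℝ E]
  [finiteDimensional : FiniteDimensional ℝ E]
  [topologicalSpace : TopologicalSpace carrier]
  [t2Space : T2Space carrier]
  [secondCountable : SecondCountableTopology carrier]
  [chartedSpace : ChartedSpace E carrier]
  [isManifold : IsManifold 𝓘(ℝ, E) ∞ carrier]
  /-- The smooth Riemannian metric. -/
  metric : Bundle.ContMDiffRiemannianMetric 𝓘(ℝ, E) ∞ E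
    (fun x : carrier => TangentSpace 𝓘(ℝ, E) x)

attribute [instance] RiemMfd.normedAddCommGroup RiemMfd.normedSpace RiemMfd.finiteDimensional
  RiemMfd.topologicalSpace RiemMfd.t2Space RiemMfd.secondCountable RiemMfd.chartedSpace
  RiemMfd.isManifold

namespace RiemMfd

instance : CoeSort RiemMfd Type := ⟨RiemMfd.carrier⟩

/-- The tangent space at `p`. -/
abbrev T (M : RiemMfd) (p : M) : Type := TangentSpace 𝓘(ℝ, M.E) p

/-- The metric `g_p(u, v)`. -/
def g (M : RiemMfd) (p : M) (u v : M.T p) : ℝ := M.metric.inner p u v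

/-- The metric read in the preferred chart at `p`: for a point `y` of the chart domain in `E`, the
bilinear form `(u, v) ↦ g(dφ⁻¹ u, dφ⁻¹ v)`. -/
def coordMetric (M : RiemMfd) (p : M) (y : M.E) : M.E →L[ℝ] M.E →L[ℝ] ℝ :=
  let q : M := (extChartAt 𝓘(ℝ, M.E) p).symm y
  let A : M.E →L[ℝ] M.E := mfderiv 𝓘(ℝ, M.E) 𝓘(ℝ, M.E) (extChartAt 𝓘(ℝ, M.E) p).symm y
  let G : M.E →L[ℝ] M.E →L[ℝ] ℝ := M.metric.inner q
  G.bilinearComp A A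

/-- The Ricci curvature at `p`. The tangent space at `p` is identified with `E` through the preferred
chart at `p`. -/
def ricci (M : RiemMfd) (p : M) (u v : M.T p) : ℝ :=
  Coord.ricci (M.coordMetric p) (extChartAt 𝓘(ℝ, M.E) p p) u v

/-- The Hessian of `f` at `p`. -/
def hess (M : RiemMfd) (f : M → ℝ) (p : M) (u v : M.T p) : ℝ :=
  Coord.hess (M.coordMetric p) (fun y => f ((extChartAt 𝓘(ℝ, M.E) p).symm y))
    (extChartAt 𝓘(ℝ, M.E) p p) u v

/-- The trace with respect to the metric of a bilinear form on the tangent space at `p`. -/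
def metricTrace (M : RiemMfd) (p : M) (B : M.T p → M.T p → ℝ) : ℝ :=
  Coord.metricTrace (E := M.E) (M.metric.inner p) B

/-- The scalar curvature. -/
def scal (M : RiemMfd) (p : M) : ℝ := M.metricTrace p (M.ricci p)

/-- The Laplacian `Δf = tr Hess f`. -/
def laplacian (M : RiemMfd) (f : M → ℝ) (p : M) : ℝ := M.metricTrace p (M.hess f p)

/-- The gradient. -/
def grad (M : RiemMfd) (f : M → ℝ) (p : M) : M.T p :=
  Coord.sharp (E := M.E) (M.metric.inner p) (mfderiv 𝓘(ℝ, M.E) 𝓘(ℝ, ℝ) f p)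

open scoped Bundle in
/-- The distance of `M`: the infimum of the lengths of `C^1` paths. -/
def riemDist (M : RiemMfd) (x y : M) : ℝ≥0∞ :=
  letI : Bundle.RiemannianBundle (fun x : M => TangentSpace 𝓘(ℝ, M.E) x) :=
    ⟨M.metric.toRiemannianMetric⟩
  Manifold.riemannianEDist 𝓘(ℝ, M.E) x y

/-- Completeness: every Cauchy sequence for the Riemannian distance converges. -/
def IsComplete (M : RiemMfd) : Prop :=
  ∀ u : ℕ → M, (∀ ε : ℝ≥0∞, 0 < ε → ∃ N, ∀ i ≥ N, ∀ j ≥ N, M.riemDist (u i) (u j) < ε) →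
    ∃ x : M, Filter.Tendsto u Filter.atTop (𝓝 x)

/-- `M` is an Einstein manifold: `Ric = c g` for some constant `c`. -/
def IsEinstein (M : RiemMfd) : Prop :=
  ∃ c : ℝ, ∀ (p : M) (u v : M.T p), M.ricci p u v = c * M.g p u v

/-- `(M, g, w)` is a `(lam, n + m)`-Einstein manifold, `n = dim M` (as `M` has no boundary, the
condition `w = 0` on the boundary is void). -/
structure IsQuasiEinstein (M : RiemMfd) (lam m : ℝ) (w : M → ℝ) : Prop where
  complete : M.IsComplete
  smooth : ContMDiff 𝓘(ℝ, M.E) 𝓘(ℝ, ℝ) ∞ w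
  hess_eq : ∀ (p : M) (u v : M.T p),
    M.hess w p u v = w p / m * (M.ricci p u v - lam * M.g p u v)
  pos : ∀ p, 0 < w p
  laplacian_eq : m = 1 → ∀ p, M.laplacian w p = -lam * w p

/-- The function `w Δw + (m - 1)|∇w|² + lam w²`. It is constant for a `(lam, n + m)`-Einstein
manifold; its value is the constant `μ`. -/
def mu (M : RiemMfd) (lam m : ℝ) (w : M → ℝ) (p : M) : ℝ :=
  w p * M.laplacian w p + (m - 1) * M.g p (M.grad w p) (M.grad w p) + lam * w p ^ 2

/-- `P` is (isometric to) the Riemannian product of `M` and `N`. -/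
def IsRiemProduct (M N P : RiemMfd) : Prop :=
  ∃ Φ : Diffeomorph (𝓘(ℝ, M.E).prod 𝓘(ℝ, N.E)) 𝓘(ℝ, P.E) (M × N) P ∞,
    ∀ (x : M × N) (u v : TangentSpace (𝓘(ℝ, M.E).prod 𝓘(ℝ, N.E)) x),
      P.g (Φ x) (mfderiv (𝓘(ℝ, M.E).prod 𝓘(ℝ, N.E)) 𝓘(ℝ, P.E) Φ x u)
          (mfderiv (𝓘(ℝ, M.E).prod 𝓘(ℝ, N.E)) 𝓘(ℝ, P.E) Φ x v) =
        M.g x.1 (mfderiv (𝓘(ℝ, M.E).prod 𝓘(ℝ, N.E)) 𝓘(ℝ, M.E) Prod.fst x u)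
            (mfderiv (𝓘(ℝ, M.E).prod 𝓘(ℝ, N.E)) 𝓘(ℝ, M.E) Prod.fst x v) +
          N.g x.2 (mfderiv (𝓘(ℝ, M.E).prod 𝓘(ℝ, N.E)) 𝓘(ℝ, N.E) Prod.snd x u)
            (mfderiv (𝓘(ℝ, M.E).prod 𝓘(ℝ, N.E)) 𝓘(ℝ, N.E) Prod.snd x v)

/-- `M` is a product of (one or more) Einstein manifolds. -/
inductive IsProductOfEinstein : RiemMfd → Prop
  | of_einstein (M : RiemMfd) : M.IsEinstein → IsProductOfEinstein M
  | of_product (M N P : RiemMfd) : IsProductOfEinstein M → IsProductOfEinstein N →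
      IsRiemProduct M N P → IsProductOfEinstein P

/-- `N` is a universal Riemannian cover of `M`. -/
def IsUniversalCover (N M : RiemMfd) : Prop :=
  SimplyConnectedSpace N ∧ ∃ φ : N → M, IsCoveringMap φ ∧ Function.Surjective φ ∧
    IsLocalDiffeomorph 𝓘(ℝ, N.E) 𝓘(ℝ, M.E) ∞ φ ∧
    ∀ (x : N) (u v : N.T x),
      M.g (φ x) (mfderiv 𝓘(ℝ, N.E) 𝓘(ℝ, M.E) φ x u) (mfderiv 𝓘(ℝ, N.E) 𝓘(ℝ, M.E) φ x v) =
        N.g x u v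

/-- `M` is rigid: it is Einstein or its universal cover is a product of Einstein manifolds. -/
def IsRigid (M : RiemMfd) : Prop :=
  M.IsEinstein ∨ ∃ N : RiemMfd, IsUniversalCover N M ∧ IsProductOfEinstein N

end RiemMfd

/-! ### The solvable Lie groups -/

/-- The action of `X₁` on the span of `X₂, X₃`. -/
def matA (α β : ℝ) : Matrix (Fin 2) (Fin 2) ℝ := !![α, β; β, 2 - α]

/-- The action of `X₀` on the span of `X₂, X₃`. -/
def matF (α β z : ℝ) : Matrix (Fin 2) (Fin 2) ℝ :=
  !![-(z * (2 - 3 * α + α ^ 2 + β ^ 2)), z * β; z * β, -(z * (-α + α ^ 2 + β ^ 2))]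

/-- The simply connected Lie group `ℝ² ⋉ ℝ²` in which `(s, t) ∈ ℝ²` acts on `ℝ²` by
`exp (s F + t A)`. The underlying manifold is `ℝ⁴`. -/
def SolvGroup (_α _β _z : ℝ) : Type := Fin 4 → ℝ

namespace SolvGroup

variable {α β z : ℝ}

instance : TopologicalSpace (SolvGroup α β z) := inferInstanceAs (TopologicalSpace (Fin 4 → ℝ))
instance : T2Space (SolvGroup α β z) := inferInstanceAs (T2Space (Fin 4 → ℝ))
instance : SecondCountableTopology (SolvGroup α β z) :=
  inferInstanceAs (SecondCountableTopology (Fin 4 → ℝ))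
instance : ChartedSpace (Fin 4 → ℝ) (SolvGroup α β z) :=
  inferInstanceAs (ChartedSpace (Fin 4 → ℝ) (Fin 4 → ℝ))
instance (n : ℕ∞ω) : IsManifold 𝓘(ℝ, Fin 4 → ℝ) n (SolvGroup α β z) :=
  inferInstanceAs (IsManifold 𝓘(ℝ, Fin 4 → ℝ) n (Fin 4 → ℝ))

/-- The matrix `exp (x₀ F + x₁ A)`. -/
def expMat (α β z s t : ℝ) : Matrix (Fin 2) (Fin 2) ℝ :=
  NormedSpace.exp (s • matF α β z + t • matA α β)

/-- The element of the group with given coordinates. -/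
def mk (a b c d : ℝ) : SolvGroup α β z := (![a, b, c, d] : Fin 4 → ℝ)

instance : Mul (SolvGroup α β z) where
  mul x y :=
    let v := expMat α β z (x 0) (x 1) *ᵥ ![y 2, y 3]
    mk (x 0 + y 0) (x 1 + y 1) (x 2 + v 0) (x 3 + v 1)

instance : One (SolvGroup α β z) where
  one := mk 0 0 0 0

instance : Inv (SolvGroup α β z) where
  inv x :=
    let v := expMat α β z (-x 0) (-x 1) *ᵥ ![x 2, x 3]
    mk (-x 0) (-x 1) (-v 0) (-v 1)

theorem mk_apply (a b c d : ℝ) (i : Fin 4) :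
    (mk a b c d : SolvGroup α β z) i = (![a, b, c, d] : Fin 4 → ℝ) i := rfl

theorem mul_def (x y : SolvGroup α β z) : x * y =
    mk (x 0 + y 0) (x 1 + y 1) (x 2 + (expMat α β z (x 0) (x 1) *ᵥ ![y 2, y 3]) 0)
      (x 3 + (expMat α β z (x 0) (x 1) *ᵥ ![y 2, y 3]) 1) := rfl

theorem one_def : (1 : SolvGroup α β z) = mk 0 0 0 0 := rfl

theorem inv_def (x : SolvGroup α β z) : x⁻¹ =
    mk (-x 0) (-x 1) (-(expMat α β z (-x 0) (-x 1) *ᵥ ![x 2, x 3]) 0)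
      (-(expMat α β z (-x 0) (-x 1) *ᵥ ![x 2, x 3]) 1) := rfl

theorem matF_comm_matA (α β z : ℝ) : Commute (matF α β z) (matA α β) := by
  ext i j
  fin_cases i <;> fin_cases j <;> simp [matF, matA, Matrix.mul_apply, Fin.sum_univ_two] <;> ring

theorem expMat_add (α β z s t s' t' : ℝ) :
    expMat α β z (s + s') (t + t') = expMat α β z s t * expMat α β z s' t' := by
  unfold expMat
  rw [← Matrix.exp_add_of_commute]
  · congr 1
    module
  · have h := matF_comm_matA α β z
    exact ((((Commute.refl _).smul_left s).smul_right s').add_right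
      ((h.smul_left s).smul_right t')).add_left
      (((h.symm.smul_left t).smul_right s').add_right (((Commute.refl _).smul_left t).smul_right t'))

theorem expMat_zero (α β z : ℝ) : expMat α β z 0 0 = 1 := by
  simp [expMat]

instance : Group (SolvGroup α β z) := Group.ofLeftAxioms
  (by
    intro x y w
    funext i
    fin_cases i <;> simp [mul_def, mk_apply, expMat_add, Matrix.mul_apply, Matrix.mulVec,
      dotProduct, Fin.sum_univ_two] <;> ring)
  (by
    intro x
    funext i
    fin_cases i <;> simp [mul_def, mk_apply, one_def, expMat_zero])
  (by
    intro x
    funext i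
    fin_cases i <;> simp [mul_def, mk_apply, inv_def, one_def])

open scoped Matrix.Norms.Operator in
theorem contDiff_expMat (n : ℕ∞ω) (α β z : ℝ) :
    ContDiff ℝ n (fun p : ℝ × ℝ => expMat α β z p.1 p.2) := by
  unfold expMat
  have h : ContDiff ℝ n (NormedSpace.exp : Matrix (Fin 2) (Fin 2) ℝ → _) := by
    rw [contDiff_iff_contDiffAt]
    intro x
    exact (NormedSpace.exp_analytic (𝕂 := ℝ) x).contDiffAt
  exact h.comp (by fun_prop)

theorem contMDiff_coord (n : ℕ∞ω) (i : Fin 4) :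
    ContMDiff 𝓘(ℝ, Fin 4 → ℝ) 𝓘(ℝ, ℝ) n (fun x : SolvGroup α β z => x i) :=
  (contDiff_apply ℝ ℝ i).contMDiff

open scoped Matrix.Norms.Operator in
theorem contMDiff_expMat_apply (n : ℕ∞ω) (α β z : ℝ) (i j : Fin 2) :
    ContMDiff 𝓘(ℝ, ℝ × ℝ) 𝓘(ℝ, ℝ) n (fun p : ℝ × ℝ => expMat α β z p.1 p.2 i j) :=
  ((LinearMap.toContinuousLinearMap
    (Matrix.entryLinearMap ℝ ℝ i j)).contDiff.comp (contDiff_expMat n α β z)).contMDiff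

instance (n : ℕ∞ω) : LieGroup 𝓘(ℝ, Fin 4 → ℝ) n (SolvGroup α β z) where
  contMDiff_mul := by
    have h1 (i : Fin 4) : ContMDiff (𝓘(ℝ, Fin 4 → ℝ).prod 𝓘(ℝ, Fin 4 → ℝ)) 𝓘(ℝ, ℝ) n
        (fun p : SolvGroup α β z × SolvGroup α β z => p.1 i) :=
      (contMDiff_coord n i).comp contMDiff_fst
    have h2 (i : Fin 4) : ContMDiff (𝓘(ℝ, Fin 4 → ℝ).prod 𝓘(ℝ, Fin 4 → ℝ)) 𝓘(ℝ, ℝ) n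
        (fun p : SolvGroup α β z × SolvGroup α β z => p.2 i) :=
      (contMDiff_coord n i).comp contMDiff_snd
    have he (i j : Fin 2) : ContMDiff (𝓘(ℝ, Fin 4 → ℝ).prod 𝓘(ℝ, Fin 4 → ℝ)) 𝓘(ℝ, ℝ) n
        (fun p : SolvGroup α β z × SolvGroup α β z => expMat α β z (p.1 0) (p.1 1) i j) :=
      (contMDiff_expMat_apply n α β z i j).comp ((h1 0).prodMk_space (h1 1))
    refine contMDiff_pi_space.2 fun i => ?_
    fin_cases i
    · exact (h1 0).add (h2 0)
    · exact (h1 1).add (h2 1)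
    · simpa [mul_def, mk_apply, Matrix.mulVec, dotProduct, Fin.sum_univ_two, Pi.add_def, Pi.mul_def]
        using (h1 2).add (((he 0 0).mul (h2 2)).add ((he 0 1).mul (h2 3)))
    · simpa [mul_def, mk_apply, Matrix.mulVec, dotProduct, Fin.sum_univ_two, Pi.add_def, Pi.mul_def]
        using (h1 3).add (((he 1 0).mul (h2 2)).add ((he 1 1).mul (h2 3)))
  contMDiff_inv := by
    have h1 (i : Fin 4) : ContMDiff 𝓘(ℝ, Fin 4 → ℝ) 𝓘(ℝ, ℝ) n
        (fun p : SolvGroup α β z => p i) := contMDiff_coord n i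
    have he (i j : Fin 2) : ContMDiff 𝓘(ℝ, Fin 4 → ℝ) 𝓘(ℝ, ℝ) n
        (fun p : SolvGroup α β z => expMat α β z (-p 0) (-p 1) i j) :=
      (contMDiff_expMat_apply n α β z i j).comp ((h1 0).neg.prodMk_space (h1 1).neg)
    refine contMDiff_pi_space.2 fun i => ?_
    fin_cases i
    · exact (h1 0).neg
    · exact (h1 1).neg
    · simpa [inv_def, mk_apply, Matrix.mulVec, dotProduct, Fin.sum_univ_two, Pi.add_def, Pi.mul_def,
        Pi.neg_def] using (((he 0 0).mul (h1 2)).add ((he 0 1).mul (h1 3))).neg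
    · simpa [inv_def, mk_apply, Matrix.mulVec, dotProduct, Fin.sum_univ_two, Pi.add_def, Pi.mul_def,
        Pi.neg_def] using (((he 1 0).mul (h1 2)).add ((he 1 1).mul (h1 3))).neg

/-- The Lie algebra of the group: the tangent space at the identity, with the bracket of left
invariant vector fields. -/
abbrev LieAlg (α β z : ℝ) : Type := GroupLieAlgebra 𝓘(ℝ, Fin 4 → ℝ) (SolvGroup α β z)

/-- The standard basis vectors `X₀, X₁, X₂, X₃` of the Lie algebra (the tangent space `ℝ⁴` at the
identity). -/
def X (α β z : ℝ) (i : Fin 4) : LieAlg α β z := (Pi.single i 1 : Fin 4 → ℝ)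

/-- A smooth Riemannian metric on the group. -/
abbrev Metric (α β z : ℝ) : Type :=
  Bundle.ContMDiffRiemannianMetric 𝓘(ℝ, Fin 4 → ℝ) ∞ (Fin 4 → ℝ)
    (fun x : SolvGroup α β z => TangentSpace 𝓘(ℝ, Fin 4 → ℝ) x)

/-- The metric is left invariant: left translations are isometries. -/
def IsLeftInvariant (γ : Metric α β z) : Prop :=
  ∀ (a x : SolvGroup α β z) (u v : TangentSpace 𝓘(ℝ, Fin 4 → ℝ) x),
    γ.inner (a * x) (mfderiv 𝓘(ℝ, Fin 4 → ℝ) 𝓘(ℝ, Fin 4 → ℝ) (a * ·) x u)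
      (mfderiv 𝓘(ℝ, Fin 4 → ℝ) 𝓘(ℝ, Fin 4 → ℝ) (a * ·) x v) = γ.inner x u v

/-- The group with a Riemannian metric, as a Riemannian manifold. -/
def toRiemMfd (γ : Metric α β z) : RiemMfd where
  carrier := SolvGroup α β z
  E := Fin 4 → ℝ
  metric := γ

end SolvGroup

end

open scoped Manifold ContDiff Topology Matrix ENNReal

noncomputable section

set_option maxSynthPendingDepth 3
set_option linter.unusedSectionVars false

/-! ### Levi-Civita connection and curvature of a metric in coordinates -/

namespace Coord

variable {E : Type} [NormedAddCommGroup E] [NormedSpace ℝ E] [FiniteDimensional ℝ E]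
variable {V : Type} [NormedAddCommGroup V] [NormedSpace ℝ V] [FiniteDimensional ℝ V]

/-! Put `ρ = 2 - 2α + α² + β² = (α - 1)² + β² + 1`, so `lam = -2ρ`. Everything rests on `F = z (A -
ρ)`, together with `tr A = 2`, `tr A² = 2ρ` and `det A = 2 - ρ`. Since `A` and `F` are symmetric and
commute, the metric in the global coordinates is the flat metric on the base `ℝ²` plus the fibre
metric `P = exp (-2 (x₀F + x₁A))`. Its Ricci operator is block diagonal: on the base it is given by
`-tr F²`, `-tr A²` and `-tr (FA) = 0`, and on the fibre it is `-(tr F) F - (tr A) A`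
(`ricci_innerForm`).

For `w = exp (ρ z x₀)` the Hessian divided by `w` is `(ρz)²` on `X₀`, zero on `X₁` and `-ρzF = -ρz²
(A - ρ)` on the fibre. On `X₀`, `X₁` and the fibre the operator `Ric + 2ρ` equals `1 - z² (ρ - 1)`
times `2ρ`, `0` and `-2 (A - ρ)` respectively. Hence the quasi-Einstein equation is the single
scalar equation `m ρ z² = 2 (1 - z² (ρ - 1))`, which is what the choice of `z²` says
(`smul_hessOp`). The same equation gives `μ = 0` and the extra Laplacian condition for `m = 1`.
Completeness follows from homogeneity (`isComplete_of_transitive`).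

Rigidity is refuted by a local obstruction: the curvature operators, acting as derivations, must
annihilate `Ric`. This holds for Einstein metrics because `R(u, v)` is skew, it passes to products
because curvature splits, and it is carried between a manifold and its cover by local isometries
(`IsRigid.isRicciSemisymmetric`). Since the factors and the cover are arbitrary manifolds, this
needs the tensoriality of curvature under coordinate changes (`IsPullbackAt.fderiv_riemann`). For
the group, testing the condition at the identity on `R(X₁, v)` with `v` in the fibre would make `(A
- ρ) A² = (2 - ρ) (A - (2 - ρ))`, times the nonzero factor `1 - z² (ρ - 1)`, vanish. Its
off-diagonal entry is `(2 - ρ) β ≠ 0`. -/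

theorem isInvertible_of_posDef {G : E →L[ℝ] E →L[ℝ] ℝ} (hG : ∀ u, u ≠ 0 → 0 < G u u) :
    G.IsInvertible := by
  have hinj : Function.Injective G := by
    rw [injective_iff_map_eq_zero]
    intro u hu
    by_contra h
    have := hG u h
    simp [hu] at this
  have hd : Module.finrank ℝ E = Module.finrank ℝ (E →L[ℝ] ℝ) := by
    rw [← (LinearMap.toContinuousLinearMap (𝕜 := ℝ) (E := E) (F' := ℝ)).finrank_eq]
    exact (Subspace.dual_finrank_eq).symm
  let e := (LinearEquiv.ofInjectiveOfFinrankEq G.toLinearMap hinj hd).toContinuousLinearEquiv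
  exact ⟨e, by ext; rfl⟩

theorem apply_sharp {G : E →L[ℝ] E →L[ℝ] ℝ} (hG : ∀ u, u ≠ 0 → 0 < G u u) (ξ : E →L[ℝ] ℝ) :
    G (sharp G ξ) = ξ := by
  obtain ⟨e, he⟩ := isInvertible_of_posDef hG
  simp [sharp, ← he]

theorem eq_of_forall_apply_eq {G : E →L[ℝ] E →L[ℝ] ℝ} (hG : ∀ u, u ≠ 0 → 0 < G u u) {x y : E}
    (h : ∀ w, G x w = G y w) : x = y := by
  by_contra hne
  have h1 := hG (x - y) (sub_ne_zero.2 hne)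
  simp [map_sub, h] at h1

theorem sharp_eq {G : E →L[ℝ] E →L[ℝ] ℝ} (hG : ∀ u, u ≠ 0 → 0 < G u u) {ξ : E →L[ℝ] ℝ} {x : E}
    (h : ∀ w, G x w = ξ w) : sharp G ξ = x :=
  eq_of_forall_apply_eq hG fun w => by rw [apply_sharp hG, h]

/-- The Koszul formula. -/
theorem apply_christoffel {h : E → E →L[ℝ] E →L[ℝ] ℝ} {y : E} (hy : ∀ u, u ≠ 0 → 0 < h y u u)
    (u v w : E) : h y (christoffel h y u v) w =
      1 / 2 * (fderiv ℝ h y u v w + fderiv ℝ h y v u w - fderiv ℝ h y w u v) := by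
  rw [christoffel, apply_sharp hy]
  simp

theorem christoffel_eq {h : E → E →L[ℝ] E →L[ℝ] ℝ} {y : E} (hy : ∀ u, u ≠ 0 → 0 < h y u u)
    {u v x : E} (hx : ∀ w, h y x w =
      1 / 2 * (fderiv ℝ h y u v w + fderiv ℝ h y v u w - fderiv ℝ h y w u v)) :
    christoffel h y u v = x :=
  eq_of_forall_apply_eq hy fun w => by rw [apply_christoffel hy, hx]

/-- The Christoffel symbols as a continuous bilinear map. -/
def christoffelL (h : E → E →L[ℝ] E →L[ℝ] ℝ) (y : E) : E →L[ℝ] E →L[ℝ] E :=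
  (LinearMap.mk₂ ℝ (christoffel h y)
    (fun a b c => by
      simp only [christoffel, sharp, ← map_add]
      congr 1; ext; simp; ring)
    (fun r a b => by
      simp only [christoffel, sharp, ← map_smul]
      congr 1; ext; simp; ring)
    (fun a b c => by
      simp only [christoffel, sharp, ← map_add]
      congr 1; ext; simp; ring)
    (fun r a b => by
      simp only [christoffel, sharp, ← map_smul]
      congr 1; ext; simp; ring)).toContinuousBilinearMap

@[simp] theorem christoffelL_apply (h : E → E →L[ℝ] E →L[ℝ] ℝ) (y u v : E) :
    christoffelL h y u v = christoffel h y u v := rfl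

/-- `h` is a `C^2` Riemannian metric near `y`. -/
structure IsMetricAt (h : E → E →L[ℝ] E →L[ℝ] ℝ) (y : E) : Prop where
  contDiffAt : ContDiffAt ℝ 2 h y
  symm : ∀ᶠ y' in 𝓝 y, ∀ u v, h y' u v = h y' v u
  pos : ∀ᶠ y' in 𝓝 y, ∀ u, u ≠ 0 → 0 < h y' u u

variable {h : E → E →L[ℝ] E →L[ℝ] ℝ} {y : E}

theorem IsMetricAt.eventually (H : IsMetricAt h y) : ∀ᶠ y' in 𝓝 y, IsMetricAt h y' := by
  filter_upwards [H.contDiffAt.eventually (by simp), H.symm.eventually_nhds,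
    H.pos.eventually_nhds] with y' h1 h2 h3 using ⟨h1, h2, h3⟩

theorem IsMetricAt.differentiableAt (H : IsMetricAt h y) : DifferentiableAt ℝ h y :=
  H.contDiffAt.differentiableAt (by simp)

/-- Expanding in a finite basis reduces smoothness of an operator-valued map to finitely many
values. The condition `n ≠ ∞` lets smoothness at the point spread to a neighbourhood, where the
criterion on open sets applies. -/
theorem contDiffAt_clm_of_apply {W : Type*} [NormedAddCommGroup W] [NormedSpace ℝ W]
    {n : ℕ∞ω} (hn : n ≠ (∞ : ℕ∞ω)) {F : V → E →L[ℝ] W} {y : V}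
    (hF : ∀ u, ContDiffAt ℝ n (fun x => F x u) y) : ContDiffAt ℝ n F y := by
  have h1 : ∀ u, ∀ᶠ x in 𝓝 y, ContDiffAt ℝ n (fun x => F x u) x := fun u =>
    (hF u).eventually hn
  let b := Module.finBasis ℝ E
  have h2 : ∀ᶠ x in 𝓝 y, ∀ i, ContDiffAt ℝ n (fun x => F x (b i)) x :=
    Filter.eventually_all.2 fun i => h1 _
  obtain ⟨s, hs, hs'⟩ := eventually_nhds_iff.1 h2
  have : ContDiffOn ℝ n F s := by
    rw [contDiffOn_clm_apply]
    intro u x hx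
    have : (fun x => F x u) = fun x => ∑ i, b.repr u i • F x (b i) := by
      funext x
      conv_lhs => rw [← b.sum_repr u, map_sum]
      simp only [map_smul]
    rw [this]
    exact ContDiffWithinAt.sum fun i _ => ((hs x hx i).contDiffWithinAt).const_smul _
  exact this.contDiffAt (hs'.1.mem_nhds hs'.2)

theorem contDiffAt_clm_of_apply₂ {W : Type*} [NormedAddCommGroup W] [NormedSpace ℝ W]
    {n : ℕ∞ω} (hn : n ≠ (∞ : ℕ∞ω)) {F : V → E →L[ℝ] E →L[ℝ] W} {y : V}
    (hF : ∀ u v, ContDiffAt ℝ n (fun x => F x u v) y) : ContDiffAt ℝ n F y :=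
  contDiffAt_clm_of_apply hn fun u => contDiffAt_clm_of_apply hn fun v => hF u v

/-- Inversion of operators is smooth at an invertible one, and one derivative of the `C^2` metric is
spent. One derivative remains, as the curvature requires. -/
theorem IsMetricAt.contDiffAt_christoffel (H : IsMetricAt h y) (u v : E) :
    ContDiffAt ℝ 1 (fun y' => christoffel h y' u v) y := by
  have h1 : ContDiffAt ℝ 1 (fderiv ℝ h) y := H.contDiffAt.fderiv_right (by norm_num)
  have h2 : ContDiffAt ℝ 1 (fun y' => (h y').inverse) y := by
    obtain ⟨e, he⟩ := isInvertible_of_posDef H.pos.self_of_nhds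
    have := contDiffAt_map_inverse (n := 1) e
    rw [he] at this
    exact this.comp y (H.contDiffAt.of_le (by norm_num))
  unfold christoffel sharp
  refine h2.clm_apply (ContDiffAt.const_smul _ (ContDiffAt.sub (ContDiffAt.add ?_ ?_) ?_))
  · exact (h1.clm_apply contDiffAt_const).clm_apply contDiffAt_const
  · exact (h1.clm_apply contDiffAt_const).clm_apply contDiffAt_const
  · have h3 : ContDiffAt ℝ 1 (fun y' => (fderiv ℝ h y').flip u) y :=
      ((ContinuousLinearMap.flipₗᵢ ℝ E E (E →L[ℝ] ℝ)).contDiff.contDiffAt.comp y h1).clm_apply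
        contDiffAt_const
    exact ((ContinuousLinearMap.flipₗᵢ ℝ E E ℝ).contDiff.contDiffAt.comp y h3).clm_apply
        contDiffAt_const

theorem IsMetricAt.contDiffAt_christoffelL (H : IsMetricAt h y) :
    ContDiffAt ℝ 1 (christoffelL h) y :=
  contDiffAt_clm_of_apply₂ (by simp) H.contDiffAt_christoffel

theorem IsMetricAt.differentiableAt_christoffelL (H : IsMetricAt h y) :
    DifferentiableAt ℝ (christoffelL h) y := H.contDiffAt_christoffelL.differentiableAt (by simp)

theorem IsMetricAt.fderiv_christoffel (H : IsMetricAt h y) (u v w : E) :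
    fderiv ℝ (fun y' => christoffel h y' v w) y u = fderiv ℝ (christoffelL h) y u v w := by
  have h1 := ((H.differentiableAt_christoffelL.hasFDerivAt.clm_apply
    (hasFDerivAt_const v y)).clm_apply (hasFDerivAt_const w y)).fderiv
  simp only [christoffelL_apply] at h1
  rw [h1]
  simp

theorem IsMetricAt.riemann_eq (H : IsMetricAt h y) (u v w : E) :
    riemann h y u v w = fderiv ℝ (christoffelL h) y u v w - fderiv ℝ (christoffelL h) y v u w
      + christoffelL h y u (christoffelL h y v w)
      - christoffelL h y v (christoffelL h y u w) := by
  rw [riemann, H.fderiv_christoffel, H.fderiv_christoffel]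
  rfl

/-- The curvature operator `w ↦ R(w, u)v`, whose trace is the Ricci curvature. -/
def curvatureMap (H : IsMetricAt h y) (u v : E) : E →ₗ[ℝ] E where
  toFun w := riemann h y w u v
  map_add' a b := by simp only [H.riemann_eq, map_add, add_apply]; abel
  map_smul' r a := by
    simp only [H.riemann_eq, map_smul, smul_apply, RingHom.id_apply]; module

theorem IsMetricAt.ricci_eq (H : IsMetricAt h y) (u v : E) :
    ricci h y u v = LinearMap.trace ℝ E (curvatureMap H u v) := by
  rw [LinearMap.trace_eq_matrix_trace ℝ (Module.finBasis ℝ E), Matrix.trace, ricci]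
  simp [LinearMap.toMatrix_apply, curvatureMap]

/-- This is metric compatibility of the connection. Adding the Koszul formulas for `(u, v; w)` and
`(u, w; v)`, all derivatives except those in direction `u` cancel by the symmetry of the metric. -/
theorem IsMetricAt.fderiv_apply (H : IsMetricAt h y) (u v w : E) :
    fderiv ℝ h y u v w = h y (christoffel h y u v) w + h y v (christoffel h y u w) := by
  have hp := H.pos.self_of_nhds
  have hs := H.symm.self_of_nhds
  have hd : ∀ a b c, fderiv ℝ h y a b c = fderiv ℝ h y a c b := by
    intro a b c
    have h1 : ∀ b c, fderiv ℝ h y a b c = fderiv ℝ (fun y' => h y' b c) y a := by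
      intro b c
      rw [((H.differentiableAt.hasFDerivAt.clm_apply
        (hasFDerivAt_const b y)).clm_apply (hasFDerivAt_const c y)).fderiv]
      simp
    rw [h1, h1]
    congr 1
    apply Filter.EventuallyEq.fderiv_eq
    filter_upwards [H.symm] with y' hy' using hy' _ _
  rw [hs v, apply_christoffel hp, apply_christoffel hp, hd u w v, hd v u w, hd w u v]
  ring

/-- `R(u, v)` is skew-symmetric. -/
theorem IsMetricAt.apply_riemann_self (H : IsMetricAt h y) (u v w : E) :
    h y (riemann h y u v w) w = 0 := by
  have hs := H.symm.self_of_nhds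
  -- Metric compatibility is differentiated once more. The skew part in `u, v` of the right side is
  -- `2 h(R(u, v)w, w)`, while second derivatives of the metric commute, so that part vanishes.
  have h2 : ∀ u v : E, fderiv ℝ (fderiv ℝ h) y u v w w =
      2 * (h y (christoffel h y u (christoffel h y v w)) w
        + h y (christoffel h y v w) (christoffel h y u w)
        + h y (fderiv ℝ (christoffelL h) y u v w) w) := by
    intro u v
    have e : (fun y' => fderiv ℝ h y' v w w) =ᶠ[𝓝 y] fun y' => 2 * h y' (christoffelL h y' v w) w := by
      filter_upwards [H.eventually] with y' H'
      rw [H'.fderiv_apply, H'.symm.self_of_nhds w]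
      simp; ring
    have e1 := DFunLike.congr_fun (e.fderiv_eq (𝕜 := ℝ)) u
    have hf : DifferentiableAt ℝ (fderiv ℝ h) y :=
      (H.contDiffAt.fderiv_right (m := 1) (by norm_num)).differentiableAt (by simp)
    rw [((((hf.hasFDerivAt.clm_apply (hasFDerivAt_const v y)).clm_apply
      (hasFDerivAt_const w y)).clm_apply (hasFDerivAt_const w y))).fderiv,
      ((((H.differentiableAt.hasFDerivAt.clm_apply
        ((H.differentiableAt_christoffelL.hasFDerivAt.clm_apply (hasFDerivAt_const v y)).clm_apply
          (hasFDerivAt_const w y))).clm_apply (hasFDerivAt_const w y))).const_mul (2 : ℝ)).fderiv] at e1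
    simp at e1
    rw [e1, H.fderiv_apply]
    ring
  have hsymm : fderiv ℝ (fderiv ℝ h) y u v w w = fderiv ℝ (fderiv ℝ h) y v u w w := by
    have := H.contDiffAt.isSymmSndFDerivAt (by simp)
    rw [this.eq u v]
  rw [h2, h2, hs (christoffel h y v w)] at hsymm
  rw [H.riemann_eq]
  simp only [map_add, map_sub, add_apply, sub_apply,
    christoffelL_apply]
  linarith

/-! ### Change of coordinates -/

/-- The metric `k` is, near `y`, the pullback of the metric `h` by the local diffeomorphism `f`. -/
structure IsPullbackAt (k : V → V →L[ℝ] V →L[ℝ] ℝ) (h : E → E →L[ℝ] E →L[ℝ] ℝ) (f : V → E)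
    (y : V) : Prop where
  contDiffAt : ContDiffAt ℝ 3 f y
  bijective : Function.Bijective (fderiv ℝ f y)
  eq : ∀ᶠ y' in 𝓝 y, ∀ u v, k y' u v = h (f y') (fderiv ℝ f y' u) (fderiv ℝ f y' v)

variable {k : V → V →L[ℝ] V →L[ℝ] ℝ} {f : V → E} {y : V}

theorem bijective_iff_isInvertible (L : V →L[ℝ] E) : Function.Bijective L ↔ L.IsInvertible := by
  constructor
  · intro hL
    exact ⟨(LinearEquiv.ofBijective L.toLinearMap hL).toContinuousLinearEquiv, by ext; rfl⟩
  · rintro ⟨e, rfl⟩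
    exact e.bijective

theorem IsPullbackAt.eventually (P : IsPullbackAt k h f y) : ∀ᶠ y' in 𝓝 y, IsPullbackAt k h f y' := by
  have hc : ContinuousAt (fderiv ℝ f) y :=
    (P.contDiffAt.fderiv_right (m := 2) (by norm_num)).continuousAt
  obtain ⟨e, he⟩ := (bijective_iff_isInvertible _).1 P.bijective
  have h1 : ∀ᶠ L : V →L[ℝ] E in 𝓝 (fderiv ℝ f y), Function.Bijective L := by
    rw [← he]
    filter_upwards [e.nhds] with L hL
    obtain ⟨e', rfl⟩ := hL
    exact e'.bijective
  filter_upwards [P.contDiffAt.eventually (by simp), hc.eventually h1, P.eq.eventually_nhds]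
    with y' a b c using ⟨a, b, c⟩

theorem IsPullbackAt.isMetricAt (P : IsPullbackAt k h f y) (H : IsMetricAt h (f y)) :
    IsMetricAt k y where
  contDiffAt := by
    have h1 : ContDiffAt ℝ 2 (fderiv ℝ f) y := P.contDiffAt.fderiv_right (by norm_num)
    have h2 : ContDiffAt ℝ 2 (fun y' => h (f y')) y :=
      H.contDiffAt.comp y (P.contDiffAt.of_le (by norm_num))
    refine contDiffAt_clm_of_apply₂ (by simp) fun u v => ?_
    refine ContDiffAt.congr_of_eventuallyEq ?_ (P.eq.mono fun y' hy' => hy' u v)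
    exact (h2.clm_apply (h1.clm_apply contDiffAt_const)).clm_apply (h1.clm_apply contDiffAt_const)
  symm := by
    filter_upwards [P.eq, P.contDiffAt.continuousAt.eventually H.symm] with y' a b u v
    rw [a, a, b]
  pos := by
    filter_upwards [P.eventually, P.contDiffAt.continuousAt.eventually H.pos] with y' a b u hu
    rw [a.eq.self_of_nhds]
    exact b _ ((map_ne_zero_iff _ a.bijective.1).2 hu)

/-- Differentiating the pullback identity gives `hd`. In the Koszul combination the terms with
second derivatives of `f` collapse, by their symmetry, to the single inhomogeneous term. -/
theorem IsPullbackAt.fderiv_christoffel (P : IsPullbackAt k h f y) (H : IsMetricAt h (f y))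
    (u v : V) : fderiv ℝ f y (christoffel k y u v) =
      christoffel h (f y) (fderiv ℝ f y u) (fderiv ℝ f y v) + fderiv ℝ (fderiv ℝ f) y u v := by
  have K := P.isMetricAt H
  have hp := H.pos.self_of_nhds
  have hs := H.symm.self_of_nhds
  have hf : DifferentiableAt ℝ f y := P.contDiffAt.differentiableAt (by simp)
  have hf2 : DifferentiableAt ℝ (fderiv ℝ f) y :=
      (P.contDiffAt.fderiv_right (m := 2) (by norm_num)).differentiableAt (by simp)
  have hsymm : ∀ u v, fderiv ℝ (fderiv ℝ f) y u v = fderiv ℝ (fderiv ℝ f) y v u := fun u v =>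
    (P.contDiffAt.isSymmSndFDerivAt (by simp; norm_num)).eq u v
  have hd : ∀ u v w : V, fderiv ℝ k y u v w =
      fderiv ℝ h (f y) (fderiv ℝ f y u) (fderiv ℝ f y v) (fderiv ℝ f y w)
      + h (f y) (fderiv ℝ (fderiv ℝ f) y u v) (fderiv ℝ f y w)
      + h (f y) (fderiv ℝ f y v) (fderiv ℝ (fderiv ℝ f) y u w) := by
    intro u v w
    have e : (fun y' => k y' v w) =ᶠ[𝓝 y] fun y' =>
        h (f y') (fderiv ℝ f y' v) (fderiv ℝ f y' w) := P.eq.mono fun y' hy' => hy' v w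
    have e1 := DFunLike.congr_fun (e.fderiv_eq (𝕜 := ℝ)) u
    rw [((K.differentiableAt.hasFDerivAt.clm_apply (hasFDerivAt_const v y)).clm_apply
      (hasFDerivAt_const w y)).fderiv] at e1
    erw [((HasFDerivAt.clm_apply (H.differentiableAt.hasFDerivAt.comp y hf.hasFDerivAt)
        (hf2.hasFDerivAt.clm_apply (hasFDerivAt_const v y))).clm_apply
        (hf2.hasFDerivAt.clm_apply (hasFDerivAt_const w y))).fderiv] at e1
    simp at e1
    rw [e1]
    ring
  refine eq_of_forall_apply_eq hp fun w' => ?_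
  obtain ⟨w, rfl⟩ := P.bijective.2 w'
  rw [← P.eq.self_of_nhds, apply_christoffel K.pos.self_of_nhds, hd, hd, hd, map_add,
    add_apply, apply_christoffel hp, hsymm v u, hsymm w u, hsymm w v,
    hs _ (fderiv ℝ (fderiv ℝ f) y v w), hs _ (fderiv ℝ (fderiv ℝ f) y u w)]
  ring

/-- Tensoriality comes from differentiating the transformation law of the Christoffel symbols. After
skew-symmetrization in `u, v` the third derivatives of `f` cancel, and the second derivatives cancel
against those produced by the quadratic terms of the curvature. -/
theorem IsPullbackAt.fderiv_riemann (P : IsPullbackAt k h f y) (H : IsMetricAt h (f y))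
    (u v w : V) : fderiv ℝ f y (riemann k y u v w) =
      riemann h (f y) (fderiv ℝ f y u) (fderiv ℝ f y v) (fderiv ℝ f y w) := by
  have K := P.isMetricAt H
  have hf : DifferentiableAt ℝ f y := P.contDiffAt.differentiableAt (by simp)
  have c2 : ContDiffAt ℝ 2 (fderiv ℝ f) y := P.contDiffAt.fderiv_right (m := 2) (by norm_num)
  have hf2 : DifferentiableAt ℝ (fderiv ℝ f) y := c2.differentiableAt (by simp)
  have hf3 : DifferentiableAt ℝ (fderiv ℝ (fderiv ℝ f)) y :=
    (c2.fderiv_right (m := 1) (by norm_num)).differentiableAt (by simp)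
  have hsymm : ∀ u v, fderiv ℝ (fderiv ℝ f) y u v = fderiv ℝ (fderiv ℝ f) y v u := fun u v =>
    (P.contDiffAt.isSymmSndFDerivAt (by simp; norm_num)).eq u v
  have hsymm3 : ∀ u v w, fderiv ℝ (fderiv ℝ (fderiv ℝ f)) y u v w =
      fderiv ℝ (fderiv ℝ (fderiv ℝ f)) y v u w := fun u v w => by
    rw [(c2.isSymmSndFDerivAt (by simp)).eq u v]
  have key : ∀ u v : V, fderiv ℝ f y (fderiv ℝ (christoffelL k) y u v w) =
      fderiv ℝ (fderiv ℝ (fderiv ℝ f)) y u v w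
      + fderiv ℝ (christoffelL h) (f y) (fderiv ℝ f y u) (fderiv ℝ f y v) (fderiv ℝ f y w)
      + christoffel h (f y) (fderiv ℝ (fderiv ℝ f) y u v) (fderiv ℝ f y w)
      + christoffel h (f y) (fderiv ℝ f y v) (fderiv ℝ (fderiv ℝ f) y u w)
      - fderiv ℝ (fderiv ℝ f) y u (christoffel k y v w) := by
    intro u v
    have e : (fun y' => fderiv ℝ f y' (christoffelL k y' v w)) =ᶠ[𝓝 y] fun y' =>
        christoffelL h (f y') (fderiv ℝ f y' v) (fderiv ℝ f y' w)
          + fderiv ℝ (fderiv ℝ f) y' v w := by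
      filter_upwards [P.eventually, P.contDiffAt.continuousAt.eventually H.eventually]
        with y' P' H' using P'.fderiv_christoffel H' v w
    have e1 := DFunLike.congr_fun (e.fderiv_eq (𝕜 := ℝ)) u
    rw [(hf2.hasFDerivAt.clm_apply ((K.differentiableAt_christoffelL.hasFDerivAt.clm_apply
        (hasFDerivAt_const v y)).clm_apply (hasFDerivAt_const w y))).fderiv] at e1
    erw [(((HasFDerivAt.clm_apply (H.differentiableAt_christoffelL.hasFDerivAt.comp y hf.hasFDerivAt)
        (hf2.hasFDerivAt.clm_apply (hasFDerivAt_const v y))).clm_apply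
        (hf2.hasFDerivAt.clm_apply (hasFDerivAt_const w y))).add
        ((hf3.hasFDerivAt.clm_apply (hasFDerivAt_const v y)).clm_apply
          (hasFDerivAt_const w y))).fderiv] at e1
    simp at e1
    rw [eq_sub_iff_add_eq, e1]
    abel
  rw [K.riemann_eq, H.riemann_eq]
  simp only [map_add, map_sub, christoffelL_apply, key, P.fderiv_christoffel H]
  simp only [← christoffelL_apply h, map_add, hsymm v u, hsymm3 v u]
  abel

/-- By tensoriality the two curvature endomorphisms are conjugate through the derivative of `f`, so
their traces agree. -/
theorem IsPullbackAt.ricci (P : IsPullbackAt k h f y) (H : IsMetricAt h (f y)) (u v : V) :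
    ricci k y u v = Coord.ricci h (f y) (fderiv ℝ f y u) (fderiv ℝ f y v) := by
  have K := P.isMetricAt H
  let e : V ≃ₗ[ℝ] E := LinearEquiv.ofBijective (fderiv ℝ f y).toLinearMap P.bijective
  rw [K.ricci_eq, H.ricci_eq, ← LinearMap.trace_conj' _ e]
  congr 1
  ext w'
  obtain ⟨w, rfl⟩ := e.surjective w'
  rw [LinearEquiv.conj_apply_apply, e.symm_apply_apply]
  exact P.fderiv_riemann H w u v

/-! ### Ricci semisymmetric metrics -/

/-- The curvature operators `R(u, v)`, acting as derivations, annihilate the Ricci tensor. -/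
def RicciSemisymmetricAt (h : E → E →L[ℝ] E →L[ℝ] ℝ) (y : E) : Prop :=
  ∀ u v w, ricci h y (riemann h y u v w) w + ricci h y w (riemann h y u v w) = 0

theorem IsPullbackAt.ricciSemisymmetricAt_iff (P : IsPullbackAt k h f y)
    (H : IsMetricAt h (f y)) : RicciSemisymmetricAt k y ↔ RicciSemisymmetricAt h (f y) := by
  constructor
  · intro hk u' v' w'
    obtain ⟨u, rfl⟩ := P.bijective.2 u'
    obtain ⟨v, rfl⟩ := P.bijective.2 v'
    obtain ⟨w, rfl⟩ := P.bijective.2 w'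
    rw [← P.fderiv_riemann H, ← P.ricci H, ← P.ricci H]
    exact hk u v w
  · intro hk u v w
    rw [P.ricci H, P.ricci H, P.fderiv_riemann H]
    exact hk _ _ _

theorem IsMetricAt.ricciSemisymmetricAt_of_einstein {h : E → E →L[ℝ] E →L[ℝ] ℝ} {y : E}
    (H : IsMetricAt h y) {c : ℝ}
    (hc : ∀ u v, ricci h y u v = c * h y u v) : RicciSemisymmetricAt h y := by
  intro u v w
  rw [hc, hc, H.symm.self_of_nhds w, H.apply_riemann_self]
  simp

/-! ### Products -/

/-- The product of two metrics. -/
def prodMetric (h : E → E →L[ℝ] E →L[ℝ] ℝ) (k : V → V →L[ℝ] V →L[ℝ] ℝ) (p : E × V) :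
    (E × V) →L[ℝ] (E × V) →L[ℝ] ℝ :=
  (h p.1).bilinearComp (ContinuousLinearMap.fst ℝ E V) (ContinuousLinearMap.fst ℝ E V)
    + (k p.2).bilinearComp (ContinuousLinearMap.snd ℝ E V) (ContinuousLinearMap.snd ℝ E V)

theorem prodMetric_apply (h : E → E →L[ℝ] E →L[ℝ] ℝ) (k : V → V →L[ℝ] V →L[ℝ] ℝ) (p u v : E × V) :
    prodMetric h k p u v = h p.1 u.1 v.1 + k p.2 u.2 v.2 := by
  simp [prodMetric]

variable {x : E}

theorem IsMetricAt.prod (H : IsMetricAt h x) (K : IsMetricAt k y) :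
    IsMetricAt (prodMetric h k) (x, y) where
  contDiffAt := by
    have h1 : ContDiffAt ℝ 2 (fun p : E × V => h p.1) (x, y) :=
      H.contDiffAt.comp (x, y) contDiffAt_fst
    have h2 : ContDiffAt ℝ 2 (fun p : E × V => k p.2) (x, y) :=
      K.contDiffAt.comp (x, y) contDiffAt_snd
    refine contDiffAt_clm_of_apply₂ (by simp) fun u v => ?_
    simp only [prodMetric_apply]
    exact ((h1.clm_apply contDiffAt_const).clm_apply contDiffAt_const).add
      ((h2.clm_apply contDiffAt_const).clm_apply contDiffAt_const)
  symm := by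
    filter_upwards [H.symm.prod_nhds K.symm] with p hp u v
    rw [prodMetric_apply, prodMetric_apply, hp.1, hp.2]
  pos := by
    filter_upwards [H.pos.prod_nhds K.pos] with p hp u hu
    rw [prodMetric_apply]
    have h1 : 0 ≤ h p.1 u.1 u.1 := by
      by_cases h0 : u.1 = 0
      · simp [h0]
      · exact (hp.1 _ h0).le
    have h2 : 0 ≤ k p.2 u.2 u.2 := by
      by_cases h0 : u.2 = 0
      · simp [h0]
      · exact (hp.2 _ h0).le
    by_cases h0 : u.1 = 0
    · have : u.2 ≠ 0 := fun h' => hu (Prod.ext h0 h')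
      linarith [hp.2 _ this]
    · linarith [hp.1 _ h0]

theorem IsMetricAt.christoffel_prod (H : IsMetricAt h x) (K : IsMetricAt k y) (u v : E × V) :
    christoffel (prodMetric h k) (x, y) u v =
      (christoffel h x u.1 v.1, christoffel k y u.2 v.2) := by
  have HK := H.prod K
  have hd : ∀ u v w : E × V, fderiv ℝ (prodMetric h k) (x, y) u v w =
      fderiv ℝ h x u.1 v.1 w.1 + fderiv ℝ k y u.2 v.2 w.2 := by
    intro u v w
    have e1 : fderiv ℝ (fun p => prodMetric h k p v w) (x, y) u =
        fderiv ℝ (prodMetric h k) (x, y) u v w := by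
      rw [((HK.differentiableAt.hasFDerivAt.clm_apply (hasFDerivAt_const v _)).clm_apply
        (hasFDerivAt_const w _)).fderiv]
      simp
    rw [← e1]
    simp only [prodMetric_apply]
    have d1 := HasFDerivAt.comp (x, y) (f := (Prod.fst : E × V → E)) H.differentiableAt.hasFDerivAt
      (hasFDerivAt_fst (𝕜 := ℝ))
    have d2 := HasFDerivAt.comp (x, y) (f := (Prod.snd : E × V → V)) K.differentiableAt.hasFDerivAt
      (hasFDerivAt_snd (𝕜 := ℝ))
    erw [(((d1.clm_apply (hasFDerivAt_const v.1 _)).clm_apply (hasFDerivAt_const w.1 _)).add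
      ((d2.clm_apply (hasFDerivAt_const v.2 _)).clm_apply (hasFDerivAt_const w.2 _))).fderiv]
    simp
  refine christoffel_eq HK.pos.self_of_nhds fun w => ?_
  rw [prodMetric_apply, apply_christoffel H.pos.self_of_nhds, apply_christoffel K.pos.self_of_nhds,
    hd, hd, hd]
  ring

theorem IsMetricAt.riemann_prod (H : IsMetricAt h x) (K : IsMetricAt k y) (u v w : E × V) :
    riemann (prodMetric h k) (x, y) u v w =
      (riemann h x u.1 v.1 w.1, riemann k y u.2 v.2 w.2) := by
  have hd : ∀ u v w : E × V, fderiv ℝ (fun p => christoffel (prodMetric h k) p v w) (x, y) u =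
      (fderiv ℝ (fun x => christoffel h x v.1 w.1) x u.1,
        fderiv ℝ (fun y => christoffel k y v.2 w.2) y u.2) := by
    intro u v w
    have e : (fun p => christoffel (prodMetric h k) p v w) =ᶠ[𝓝 (x, y)] fun p =>
        (christoffel h p.1 v.1 w.1, christoffel k p.2 v.2 w.2) := by
      filter_upwards [H.eventually.prod_nhds K.eventually] with p hp
      exact hp.1.christoffel_prod hp.2 v w
    have d1 := HasFDerivAt.comp (x, y) (f := (Prod.fst : E × V → E))
      ((H.contDiffAt_christoffel v.1 w.1).differentiableAt (by simp)).hasFDerivAt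
      (hasFDerivAt_fst (𝕜 := ℝ))
    have d2 := HasFDerivAt.comp (x, y) (f := (Prod.snd : E × V → V))
      ((K.contDiffAt_christoffel v.2 w.2).differentiableAt (by simp)).hasFDerivAt
      (hasFDerivAt_snd (𝕜 := ℝ))
    rw [e.fderiv_eq]
    erw [(d1.prodMk d2).fderiv]
    simp
  simp only [riemann, hd, H.christoffel_prod K, Prod.mk_sub_mk, Prod.mk_add_mk]

theorem IsMetricAt.ricci_prod (H : IsMetricAt h x) (K : IsMetricAt k y) (u v : E × V) :
    ricci (prodMetric h k) (x, y) u v = ricci h x u.1 v.1 + ricci k y u.2 v.2 := by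
  rw [(H.prod K).ricci_eq, H.ricci_eq, K.ricci_eq, ← LinearMap.trace_prodMap']
  congr 1
  refine LinearMap.ext fun w => ?_
  exact H.riemann_prod K w u v

theorem IsMetricAt.ricciSemisymmetricAt_prod (H : IsMetricAt h x) (K : IsMetricAt k y)
    (hx : RicciSemisymmetricAt h x) (hy : RicciSemisymmetricAt k y) :
    RicciSemisymmetricAt (prodMetric h k) (x, y) := by
  intro u v w
  rw [H.riemann_prod K, H.ricci_prod K, H.ricci_prod K]
  linarith [hx u.1 v.1 w.1, hy u.2 v.2 w.2]

end Coord

/-! ### Coordinate metrics on manifolds; rigid manifolds are Ricci semisymmetric -/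

namespace RiemMfd

variable (M : RiemMfd)

theorem g_congr {p : M} {u u' v v' : M.T p} (hu : u = u') (hv : v = v') :
    M.g p u v = M.g p u' v' := by rw [hu, hv]

theorem g_symm (p : M) (u v : M.T p) : M.g p u v = M.g p v u := M.metric.symm p u v

theorem g_pos (p : M) (u : M.T p) (hu : u ≠ 0) : 0 < M.g p u u := M.metric.pos p u hu

/-- This links the abstract trivialization of the tangent bundle to the derivative of the chart, so
that smoothness of a section can be read off in coordinates. -/
theorem trivializationAt_snd {p q : M} (hq : q ∈ (chartAt M.E p).source) (w : M.T q) :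
    (trivializationAt M.E (TangentSpace 𝓘(ℝ, M.E)) p ⟨q, w⟩).2 =
      mfderiv 𝓘(ℝ, M.E) 𝓘(ℝ, M.E) (extChartAt 𝓘(ℝ, M.E) p) q w := by
  rw [← TangentBundle.continuousLinearMapAt_trivializationAt (I := 𝓘(ℝ, M.E)) hq]
  exact (congrFun (Bundle.Trivialization.coe_linearMapAt_of_mem (R := ℝ)
    (trivializationAt M.E (TangentSpace 𝓘(ℝ, M.E)) p) (by simpa using hq)) w).symm

theorem mfderiv_chart_comp_symm {p : M} {y : M.E} (hy : y ∈ (extChartAt 𝓘(ℝ, M.E) p).target)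
    (u : M.E) :
    mfderiv 𝓘(ℝ, M.E) 𝓘(ℝ, M.E) (extChartAt 𝓘(ℝ, M.E) p) ((extChartAt 𝓘(ℝ, M.E) p).symm y)
      (mfderiv 𝓘(ℝ, M.E) 𝓘(ℝ, M.E) (extChartAt 𝓘(ℝ, M.E) p).symm y u) = u := by
  have h := mfderiv_extChartAt_comp_mfderivWithin_extChartAt_symm hy
  rw [show Set.range 𝓘(ℝ, M.E) = Set.univ by simp, mfderivWithin_univ] at h
  exact DFunLike.congr_fun h u

theorem mfderiv_symm_comp_chart {p : M} {y : M.E} (hy : y ∈ (extChartAt 𝓘(ℝ, M.E) p).target)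
    (u : M.T ((extChartAt 𝓘(ℝ, M.E) p).symm y)) :
    mfderiv 𝓘(ℝ, M.E) 𝓘(ℝ, M.E) (extChartAt 𝓘(ℝ, M.E) p).symm y
      (mfderiv 𝓘(ℝ, M.E) 𝓘(ℝ, M.E) (extChartAt 𝓘(ℝ, M.E) p)
        ((extChartAt 𝓘(ℝ, M.E) p).symm y) u) = u := by
  have h := mfderivWithin_extChartAt_symm_comp_mfderiv_extChartAt hy
  rw [show Set.range 𝓘(ℝ, M.E) = Set.univ by simp, mfderivWithin_univ] at h
  exact DFunLike.congr_fun h u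

theorem coordMetric_apply (p : M) (y u v : M.E) :
    M.coordMetric p y u v = M.g ((extChartAt 𝓘(ℝ, M.E) p).symm y)
      (mfderiv 𝓘(ℝ, M.E) 𝓘(ℝ, M.E) (extChartAt 𝓘(ℝ, M.E) p).symm y u)
      (mfderiv 𝓘(ℝ, M.E) 𝓘(ℝ, M.E) (extChartAt 𝓘(ℝ, M.E) p).symm y v) := rfl

theorem target_mem_nhds {p : M} {y : M.E} (hy : y ∈ (extChartAt 𝓘(ℝ, M.E) p).target) :
    (extChartAt 𝓘(ℝ, M.E) p).target ∈ 𝓝 y :=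
  (isOpen_extChartAt_target p).mem_nhds hy

theorem coordMetric_chart_apply {p q : M} (hq : q ∈ (extChartAt 𝓘(ℝ, M.E) p).source)
    (u v : M.T q) :
    M.coordMetric p (extChartAt 𝓘(ℝ, M.E) p q)
      (mfderiv 𝓘(ℝ, M.E) 𝓘(ℝ, M.E) (extChartAt 𝓘(ℝ, M.E) p) q u)
      (mfderiv 𝓘(ℝ, M.E) 𝓘(ℝ, M.E) (extChartAt 𝓘(ℝ, M.E) p) q v) = M.g q u v := by
  obtain ⟨y, hy, rfl⟩ : ∃ y ∈ (extChartAt 𝓘(ℝ, M.E) p).target,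
      (extChartAt 𝓘(ℝ, M.E) p).symm y = q :=
    ⟨_, (extChartAt 𝓘(ℝ, M.E) p).map_source hq, (extChartAt 𝓘(ℝ, M.E) p).left_inv hq⟩
  rw [(extChartAt 𝓘(ℝ, M.E) p).right_inv hy]
  exact (M.coordMetric_apply p y _ _).trans
    (M.g_congr (M.mfderiv_symm_comp_chart hy u) (M.mfderiv_symm_comp_chart hy v))

/-- The preferred chart at `p` has identity derivative at `p` itself, so no change of basis
intervenes. -/
theorem coordMetric_self (p : M) (u v : M.T p) :
    M.coordMetric p (extChartAt 𝓘(ℝ, M.E) p p) u v = M.g p u v := by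
  have h := M.coordMetric_chart_apply (mem_extChartAt_source (I := 𝓘(ℝ, M.E)) p) u v
  rw [mfderiv_extChartAt_self] at h
  exact h

theorem contMDiffAt_symm_section (p : M) (u : M.E) :
    ContMDiffAt 𝓘(ℝ, M.E) (𝓘(ℝ, M.E).prod 𝓘(ℝ, M.E)) ∞
      (fun y => Bundle.TotalSpace.mk' M.E (E := fun x : M => TangentSpace 𝓘(ℝ, M.E) x)
        ((extChartAt 𝓘(ℝ, M.E) p).symm y)
        (mfderiv 𝓘(ℝ, M.E) 𝓘(ℝ, M.E) (extChartAt 𝓘(ℝ, M.E) p).symm y u))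
      (extChartAt 𝓘(ℝ, M.E) p p) := by
  have hp := mem_extChartAt_target (I := 𝓘(ℝ, M.E)) p
  rw [Bundle.contMDiffAt_totalSpace]
  refine ⟨((contMDiffOn_extChartAt_symm p) _ hp).contMDiffAt (M.target_mem_nhds hp), ?_⟩
  refine contMDiffAt_const (c := u) |>.congr_of_eventuallyEq ?_
  filter_upwards [M.target_mem_nhds hp] with y hy
  have hy' := (extChartAt 𝓘(ℝ, M.E) p).map_target hy
  rw [extChartAt_source] at hy'
  have h := (M.trivializationAt_snd hy' _).trans (M.mfderiv_chart_comp_symm hy u)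
  have hl := (extChartAt 𝓘(ℝ, M.E) p).left_inv (mem_extChartAt_source p)
  simp only [hl]
  exact h

/-- The function is the smooth metric section evaluated on two coordinate vector fields, which are
smooth because they become constant in the trivialization at `p`. -/
theorem contDiffAt_coordMetric_apply (p : M) (u v : M.E) :
    ContDiffAt ℝ ∞ (fun y => M.coordMetric p y u v) (extChartAt 𝓘(ℝ, M.E) p p) := by
  have hp := mem_extChartAt_target (I := 𝓘(ℝ, M.E)) p
  have hs : ContMDiffAt 𝓘(ℝ, M.E) 𝓘(ℝ, M.E) ∞ (extChartAt 𝓘(ℝ, M.E) p).symm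
      (extChartAt 𝓘(ℝ, M.E) p p) :=
    ((contMDiffOn_extChartAt_symm p) _ hp).contMDiffAt (M.target_mem_nhds hp)
  have h1 := ContMDiffAt.clm_bundle_apply₂ (F₁ := M.E) (F₂ := M.E) (F₃ := ℝ)
    (E₁ := fun x : M => TangentSpace 𝓘(ℝ, M.E) x) (E₂ := fun x : M => TangentSpace 𝓘(ℝ, M.E) x)
    (E₃ := Bundle.Trivial M ℝ)
    (ψ := fun y => M.metric.inner ((extChartAt 𝓘(ℝ, M.E) p).symm y))
    ((M.metric.contMDiff _).comp _ hs)
    (M.contMDiffAt_symm_section p u) (M.contMDiffAt_symm_section p v)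
  rw [Bundle.contMDiffAt_totalSpace] at h1
  exact contMDiffAt_iff_contDiffAt.1 h1.2

theorem isMetricAt_coordMetric (p : M) :
    Coord.IsMetricAt (M.coordMetric p) (extChartAt 𝓘(ℝ, M.E) p p) where
  contDiffAt := by
    exact Coord.contDiffAt_clm_of_apply₂ (by simp) fun u v =>
      (M.contDiffAt_coordMetric_apply p u v).of_le ENat.LEInfty.out
  symm := Filter.Eventually.of_forall fun y u v => by
    rw [coordMetric_apply, coordMetric_apply, g_symm]
  pos := by
    filter_upwards [M.target_mem_nhds (mem_extChartAt_target (I := 𝓘(ℝ, M.E)) p)] with y hy u hu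
    rw [coordMetric_apply]
    refine M.g_pos _ _ fun h0 => hu ?_
    exact (M.mfderiv_chart_comp_symm hy u).symm.trans ((congrArg _ h0).trans (map_zero _))

/-- Any smooth parametrization with bijective derivative may replace the inverse of the preferred
chart, the transition map being the local diffeomorphism of the pullback. It is applied to charts
followed by a covering map, and to products of charts followed by an isometry. -/
theorem isPullbackAt_chart {V : Type} [NormedAddCommGroup V] [NormedSpace ℝ V]
    [FiniteDimensional ℝ V] {ψ : V → M} {y₀ : V} {k : V → V →L[ℝ] V →L[ℝ] ℝ}
    (hψ : ContMDiffAt 𝓘(ℝ, V) 𝓘(ℝ, M.E) ∞ ψ y₀)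
    (hb : Function.Bijective (mfderiv 𝓘(ℝ, V) 𝓘(ℝ, M.E) ψ y₀))
    (hk : ∀ᶠ y in 𝓝 y₀, ∀ u v, k y u v = M.g (ψ y) (mfderiv 𝓘(ℝ, V) 𝓘(ℝ, M.E) ψ y u)
      (mfderiv 𝓘(ℝ, V) 𝓘(ℝ, M.E) ψ y v)) :
    Coord.IsPullbackAt k (M.coordMetric (ψ y₀))
      (fun y => extChartAt 𝓘(ℝ, M.E) (ψ y₀) (ψ y)) y₀ := by
  have hs : ∀ᶠ y in 𝓝 y₀, ψ y ∈ (extChartAt 𝓘(ℝ, M.E) (ψ y₀)).source :=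
    hψ.continuousAt.eventually (extChartAt_source_mem_nhds (ψ y₀))
  have hd : ∀ᶠ y in 𝓝 y₀, MDifferentiableAt 𝓘(ℝ, V) 𝓘(ℝ, M.E) ψ y := by
    have : ContMDiffAt 𝓘(ℝ, V) 𝓘(ℝ, M.E) 1 ψ y₀ := hψ.of_le (ENat.LEInfty.out)
    filter_upwards [(contMDiffAt_iff_contMDiffAt_nhds (by simp)).1 this] with y hy using hy.mdifferentiableAt (by simp)
  have hf : ∀ᶠ y in 𝓝 y₀, ∀ u, fderiv ℝ (fun y => extChartAt 𝓘(ℝ, M.E) (ψ y₀) (ψ y)) y u =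
      mfderiv 𝓘(ℝ, M.E) 𝓘(ℝ, M.E) (extChartAt 𝓘(ℝ, M.E) (ψ y₀)) (ψ y)
        (mfderiv 𝓘(ℝ, V) 𝓘(ℝ, M.E) ψ y u) := by
    filter_upwards [hs, hd] with y h1 h2 u
    rw [← mfderiv_eq_fderiv]
    have := mfderiv_comp y (mdifferentiableAt_extChartAt (I := 𝓘(ℝ, M.E)) (x := ψ y₀)
      (by simpa using h1)) h2
    exact DFunLike.congr_fun this u
  refine ⟨?_, ?_, ?_⟩
  · have := (contMDiffAt_extChartAt (I := 𝓘(ℝ, M.E)) (n := ∞) (x := ψ y₀)).comp y₀ hψ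
    exact (contMDiffAt_iff_contDiffAt.1 this).of_le (ENat.LEInfty.out)
  · have h := hf.self_of_nhds
    rw [mfderiv_extChartAt_self] at h
    have : ⇑(fderiv ℝ (fun y => extChartAt 𝓘(ℝ, M.E) (ψ y₀) (ψ y)) y₀) =
        mfderiv 𝓘(ℝ, V) 𝓘(ℝ, M.E) ψ y₀ := funext h
    rw [this]
    exact hb
  · filter_upwards [hf, hs, hk] with y h1 h2 h3 u v
    rw [h1, h1, M.coordMetric_chart_apply h2, h3]

/-- The curvature operators, acting as derivations, annihilate the Ricci tensor. -/
def IsRicciSemisymmetric : Prop :=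
  ∀ p : M, Coord.RicciSemisymmetricAt (M.coordMetric p) (extChartAt 𝓘(ℝ, M.E) p p)

variable {M}

theorem IsEinstein.isRicciSemisymmetric (h : M.IsEinstein) : M.IsRicciSemisymmetric := by
  obtain ⟨c, hc⟩ := h
  intro p
  refine (M.isMetricAt_coordMetric p).ricciSemisymmetricAt_of_einstein (c := c) fun u v => ?_
  exact (hc p u v).trans (congrArg (c * ·) (M.coordMetric_self p u v).symm)

variable {N P : RiemMfd}

/-- Only the local isometry matters: a chart of the cover followed by `φ` parametrizes the base, and
surjectivity reaches every base point. -/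
theorem IsUniversalCover.isRicciSemisymmetric (h : IsUniversalCover N M)
    (hN : N.IsRicciSemisymmetric) : M.IsRicciSemisymmetric := by
  obtain ⟨-, φ, -, hsurj, hφ, hiso⟩ := h
  intro p
  obtain ⟨x, rfl⟩ := hsurj p
  have hx := mem_extChartAt_target (I := 𝓘(ℝ, N.E)) x
  have hlx := (extChartAt 𝓘(ℝ, N.E) x).left_inv (mem_extChartAt_source x)
  have hmd : ∀ y ∈ (extChartAt 𝓘(ℝ, N.E) x).target,
      MDifferentiableAt 𝓘(ℝ, N.E) 𝓘(ℝ, N.E) (extChartAt 𝓘(ℝ, N.E) x).symm y := fun y hy =>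
    (mdifferentiableOn_extChartAt_symm y hy).mdifferentiableAt (N.target_mem_nhds hy)
  have hd : ∀ y ∈ (extChartAt 𝓘(ℝ, N.E) x).target, ∀ u,
      mfderiv 𝓘(ℝ, N.E) 𝓘(ℝ, M.E) (fun y => φ ((extChartAt 𝓘(ℝ, N.E) x).symm y)) y u =
      mfderiv 𝓘(ℝ, N.E) 𝓘(ℝ, M.E) φ ((extChartAt 𝓘(ℝ, N.E) x).symm y)
        (mfderiv 𝓘(ℝ, N.E) 𝓘(ℝ, N.E) (extChartAt 𝓘(ℝ, N.E) x).symm y u) := by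
    intro y hy u
    have := mfderiv_comp y (hφ.mdifferentiable (by simp) _) (hmd y hy)
    exact DFunLike.congr_fun this u
  have hP := M.isPullbackAt_chart (ψ := fun y => φ ((extChartAt 𝓘(ℝ, N.E) x).symm y))
    (y₀ := extChartAt 𝓘(ℝ, N.E) x x) (k := N.coordMetric x)
    (hφ.contMDiff.contMDiffAt.comp _
      (((contMDiffOn_extChartAt_symm x) _ hx).contMDiffAt (N.target_mem_nhds hx))) ?_ ?_
  · have hM := M.isMetricAt_coordMetric (φ ((extChartAt 𝓘(ℝ, N.E) x).symm
      (extChartAt 𝓘(ℝ, N.E) x x)))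
    have := (hP.ricciSemisymmetricAt_iff hM).1 (hN x)
    simp only [hlx] at this
    exact this
  · have h1 := ((hφ _).mfderivToContinuousLinearEquiv (by simp) :
      N.T ((extChartAt 𝓘(ℝ, N.E) x).symm (extChartAt 𝓘(ℝ, N.E) x x)) ≃L[ℝ] _).bijective
    have h2 : Function.Bijective (mfderiv 𝓘(ℝ, N.E) 𝓘(ℝ, N.E) (extChartAt 𝓘(ℝ, N.E) x).symm
        (extChartAt 𝓘(ℝ, N.E) x x)) :=
      Function.bijective_iff_has_inverse.2 ⟨_, N.mfderiv_chart_comp_symm hx,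
        N.mfderiv_symm_comp_chart hx⟩
    have := h1.comp h2
    convert this using 1
    exact funext fun u => hd _ hx u
  · filter_upwards [N.target_mem_nhds hx] with y hy u v
    exact (N.coordMetric_apply x y u v).trans ((hiso _ _ _).symm.trans
      (M.g_congr (hd y hy u) (hd y hy v)).symm)

theorem IsRiemProduct.isRicciSemisymmetric (h : IsRiemProduct M N P)
    (hM : M.IsRicciSemisymmetric) (hN : N.IsRicciSemisymmetric) : P.IsRicciSemisymmetric := by
  obtain ⟨Φ, hΦ⟩ := h
  intro p
  obtain ⟨⟨a, b⟩, rfl⟩ := Φ.surjective p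
  have ha := mem_extChartAt_target (I := 𝓘(ℝ, M.E)) a
  have hb := mem_extChartAt_target (I := 𝓘(ℝ, N.E)) b
  have hla := (extChartAt 𝓘(ℝ, M.E) a).left_inv (mem_extChartAt_source a)
  have hlb := (extChartAt 𝓘(ℝ, N.E) b).left_inv (mem_extChartAt_source b)
  let σ : M.E × N.E → M × N := Prod.map (extChartAt 𝓘(ℝ, M.E) a).symm (extChartAt 𝓘(ℝ, N.E) b).symm
  let y₀ : M.E × N.E := (extChartAt 𝓘(ℝ, M.E) a a, extChartAt 𝓘(ℝ, N.E) b b)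
  have hσ₀ : σ y₀ = (a, b) := by simp [σ, y₀]
  have hmM : ∀ y ∈ (extChartAt 𝓘(ℝ, M.E) a).target,
      MDifferentiableAt 𝓘(ℝ, M.E) 𝓘(ℝ, M.E) (extChartAt 𝓘(ℝ, M.E) a).symm y := fun y hy =>
    (mdifferentiableOn_extChartAt_symm y hy).mdifferentiableAt (M.target_mem_nhds hy)
  have hmN : ∀ y ∈ (extChartAt 𝓘(ℝ, N.E) b).target,
      MDifferentiableAt 𝓘(ℝ, N.E) 𝓘(ℝ, N.E) (extChartAt 𝓘(ℝ, N.E) b).symm y := fun y hy =>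
    (mdifferentiableOn_extChartAt_symm y hy).mdifferentiableAt (N.target_mem_nhds hy)
  have hσ : ∀ y : M.E × N.E, y.1 ∈ (extChartAt 𝓘(ℝ, M.E) a).target →
      y.2 ∈ (extChartAt 𝓘(ℝ, N.E) b).target →
      HasMFDerivAt 𝓘(ℝ, M.E × N.E) (𝓘(ℝ, M.E).prod 𝓘(ℝ, N.E)) σ y
        ((mfderiv 𝓘(ℝ, M.E) 𝓘(ℝ, M.E) (extChartAt 𝓘(ℝ, M.E) a).symm y.1).prodMap
          (mfderiv 𝓘(ℝ, N.E) 𝓘(ℝ, N.E) (extChartAt 𝓘(ℝ, N.E) b).symm y.2)) := by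
    intro y h1 h2
    have := (hmM _ h1).hasMFDerivAt.prodMap (hmN _ h2).hasMFDerivAt
    -- The vector space `M.E × N.E` carries its own model and the product of the two models; the
    -- rewriting identifies them.
    rw [modelWithCornersSelf_prod, ← chartedSpaceSelf_prod]
    exact this
  have hd : ∀ y : M.E × N.E, y.1 ∈ (extChartAt 𝓘(ℝ, M.E) a).target →
      y.2 ∈ (extChartAt 𝓘(ℝ, N.E) b).target → ∀ u : M.E × N.E,
      mfderiv 𝓘(ℝ, M.E × N.E) 𝓘(ℝ, P.E) (fun y => Φ (σ y)) y u =
      mfderiv (𝓘(ℝ, M.E).prod 𝓘(ℝ, N.E)) 𝓘(ℝ, P.E) Φ (σ y)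
        (mfderiv 𝓘(ℝ, M.E) 𝓘(ℝ, M.E) (extChartAt 𝓘(ℝ, M.E) a).symm y.1 u.1,
          mfderiv 𝓘(ℝ, N.E) 𝓘(ℝ, N.E) (extChartAt 𝓘(ℝ, N.E) b).symm y.2 u.2) := by
    intro y h1 h2 u
    have := HasMFDerivAt.comp y (Φ.mdifferentiable (by simp) (σ y)).hasMFDerivAt (hσ y h1 h2)
    exact DFunLike.congr_fun this.mfderiv u
  have hsmooth : ContMDiffAt 𝓘(ℝ, M.E × N.E) 𝓘(ℝ, P.E) ∞ (fun y => Φ (σ y)) y₀ := by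
    refine Φ.contMDiff.contMDiffAt.comp y₀ ?_
    rw [modelWithCornersSelf_prod, ← chartedSpaceSelf_prod]
    exact ContMDiffAt.prodMap
      (((contMDiffOn_extChartAt_symm a) _ ha).contMDiffAt (M.target_mem_nhds ha))
      (((contMDiffOn_extChartAt_symm b) _ hb).contMDiffAt (N.target_mem_nhds hb))
  have hP := P.isPullbackAt_chart (ψ := fun y => Φ (σ y))
    (y₀ := y₀) (k := Coord.prodMetric (M.coordMetric a) (N.coordMetric b)) hsmooth ?_ ?_
  · have hM' := P.isMetricAt_coordMetric (Φ (σ y₀))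
    have := (hP.ricciSemisymmetricAt_iff hM').1
      ((M.isMetricAt_coordMetric a).ricciSemisymmetricAt_prod (N.isMetricAt_coordMetric b)
        (hM a) (hN b))
    simp only [hσ₀] at this
    exact this
  · have h1 := ((Φ.isLocalDiffeomorph (σ y₀)).mfderivToContinuousLinearEquiv (by simp)).bijective
    have h2 : Function.Bijective (mfderiv 𝓘(ℝ, M.E) 𝓘(ℝ, M.E) (extChartAt 𝓘(ℝ, M.E) a).symm
        (extChartAt 𝓘(ℝ, M.E) a a)) :=
      Function.bijective_iff_has_inverse.2 ⟨_, M.mfderiv_chart_comp_symm ha,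
        M.mfderiv_symm_comp_chart ha⟩
    have h3 : Function.Bijective (mfderiv 𝓘(ℝ, N.E) 𝓘(ℝ, N.E) (extChartAt 𝓘(ℝ, N.E) b).symm
        (extChartAt 𝓘(ℝ, N.E) b b)) :=
      Function.bijective_iff_has_inverse.2 ⟨_, N.mfderiv_chart_comp_symm hb,
        N.mfderiv_symm_comp_chart hb⟩
    have := h1.comp (h2.prodMap h3)
    have h4 : ⇑(mfderiv 𝓘(ℝ, M.E × N.E) 𝓘(ℝ, P.E) (fun y => Φ (σ y)) y₀) = _ :=
      funext fun u => hd y₀ ha hb u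
    rw [h4]
    exact this
  · filter_upwards [prod_mem_nhds (M.target_mem_nhds ha) (N.target_mem_nhds hb)] with y hy u v
    refine Eq.trans ?_ (P.g_congr (hd y hy.1 hy.2 u) (hd y hy.1 hy.2 v)).symm
    refine Eq.trans ?_ (hΦ (σ y) _ _).symm
    rw [Coord.prodMetric_apply, mfderiv_fst, mfderiv_snd]
    rfl

theorem IsProductOfEinstein.isRicciSemisymmetric (h : M.IsProductOfEinstein) :
    M.IsRicciSemisymmetric := by
  induction h with
  | of_einstein M h => exact h.isRicciSemisymmetric
  | of_product M N P _ _ h hM hN => exact h.isRicciSemisymmetric hM hN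

theorem IsRigid.isRicciSemisymmetric (h : M.IsRigid) : M.IsRicciSemisymmetric := by
  rcases h with h | ⟨N, hN, h⟩
  · exact h.isRicciSemisymmetric
  · exact hN.isRicciSemisymmetric h.isRicciSemisymmetric

end RiemMfd

/-! ### Smooth families of bilinear forms as bundle sections over a vector space -/

section ModelSpace

variable {E : Type} [NormedAddCommGroup E] [NormedSpace ℝ E]

theorem trivializationAt_cotangent_apply (x b : E) (l : TangentSpace 𝓘(ℝ, E) b →L[ℝ] ℝ) (w : E) :
    (trivializationAt (E →L[ℝ] ℝ) (fun x => TangentSpace 𝓘(ℝ, E) x →L[ℝ] ℝ) x ⟨b, l⟩).2 w = l w := by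
  have h1 := congrArg (fun L => L w) (TangentBundle.symmL_model_space (𝕜 := ℝ) x b)
  refine Eq.trans ?_ (congrArg (fun u => l u) h1)
  have h := hom_trivializationAt_apply (σ := RingHom.id ℝ) (F₁ := E) (F₂ := ℝ)
    (E₁ := fun x : E => TangentSpace 𝓘(ℝ, E) x) (E₂ := fun _ : E => ℝ) x ⟨b, l⟩
  refine (DFunLike.congr_fun (congrArg Prod.snd h) w).trans ?_
  simp [ContinuousLinearMap.inCoordinates]
  rfl

/-- A smooth family of bilinear forms on a vector space is a smooth section of the bundle of
bilinear forms on the tangent spaces. -/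
theorem contMDiff_bilinearForm {B : E → E →L[ℝ] E →L[ℝ] ℝ} (hB : ContDiff ℝ ∞ B) :
    ContMDiff 𝓘(ℝ, E) (𝓘(ℝ, E).prod 𝓘(ℝ, E →L[ℝ] E →L[ℝ] ℝ)) ∞
      (fun b : E => Bundle.TotalSpace.mk' (E →L[ℝ] E →L[ℝ] ℝ)
        (E := fun x : E => TangentSpace 𝓘(ℝ, E) x →L[ℝ] TangentSpace 𝓘(ℝ, E) x →L[ℝ] ℝ) b (B b)) := by
  intro x
  refine (Bundle.contMDiffAt_section x).2 ?_
  refine hB.contMDiff.contMDiffAt.congr_of_eventuallyEq (Filter.Eventually.of_forall fun b => ?_)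
  refine ContinuousLinearMap.ext fun v => ContinuousLinearMap.ext fun w => ?_
  have h1 := congrArg (fun L => L v) (TangentBundle.symmL_model_space (𝕜 := ℝ) x b)
  refine Eq.trans ?_ (congrArg (fun u => B b u w) h1)
  have h := hom_trivializationAt_apply (σ := RingHom.id ℝ) (F₁ := E) (F₂ := E →L[ℝ] ℝ)
    (E₁ := fun x : E => TangentSpace 𝓘(ℝ, E) x)
    (E₂ := fun x : E => TangentSpace 𝓘(ℝ, E) x →L[ℝ] ℝ) x ⟨b, B b⟩
  refine (DFunLike.congr_fun (DFunLike.congr_fun (congrArg Prod.snd h) v) w).trans ?_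
  have h4 := congrFun (Bundle.Trivialization.coe_linearMapAt_of_mem (R := ℝ) (b := b)
    (trivializationAt (E →L[ℝ] ℝ) (fun x => TangentSpace 𝓘(ℝ, E) x →L[ℝ] ℝ) x)
    (by simp; exact Set.mem_univ b))
    (B b (Bundle.Trivialization.symmL ℝ (trivializationAt E (TangentSpace 𝓘(ℝ, E)) x) b v))
  exact (DFunLike.congr_fun h4 w).trans (trivializationAt_cotangent_apply x b _ w)

end ModelSpace

/-! ### The group, its Lie algebra and its left-invariant metric -/

namespace SolvGroup

variable {α β z : ℝ}

theorem simplyConnectedSpace : SimplyConnectedSpace (SolvGroup α β z) :=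
  inferInstanceAs (SimplyConnectedSpace (Fin 4 → ℝ))

/-- The projection of the group onto its abelian quotient `ℝ²`. -/
def toAbelian (α β z : ℝ) : SolvGroup α β z →* Multiplicative (ℝ × ℝ) where
  toFun x := Multiplicative.ofAdd (x 0, x 1)
  map_one' := rfl
  map_mul' _ _ := rfl

/-- The abelian normal subgroup `ℝ²` of the group. -/
def ofFiber (α β z : ℝ) : Multiplicative (ℝ × ℝ) →* SolvGroup α β z where
  toFun v := mk 0 0 v.toAdd.1 v.toAdd.2
  map_one' := rfl
  map_mul' v w := by
    funext i
    fin_cases i <;> simp [mul_def, mk_apply, expMat_zero]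

/-- The group is an extension of the abelian base `ℝ²` by the abelian fibre `ℝ²`. -/
theorem isSolvable : Group.IsSolvable (SolvGroup α β z) := by
  refine Group.isSolvable_of_ker_le_range (ofFiber α β z) (toAbelian α β z) fun x hx => ?_
  have h : (x 0, x 1) = ((0 : ℝ), (0 : ℝ)) := hx
  rw [Prod.mk.injEq] at h
  refine ⟨Multiplicative.ofAdd (x 2, x 3), ?_⟩
  funext i
  fin_cases i
  · exact h.1.symm
  · exact h.2.symm
  · rfl
  · rfl

/-! ### Derivatives of the exponential -/

/-- The endomorphism of the fibre `ℝ²` by which an element of the Lie algebra acts. -/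
def action (α β z s t : ℝ) : Matrix (Fin 2) (Fin 2) ℝ := s • matF α β z + t • matA α β

theorem expMat_eq (α β z s t : ℝ) : expMat α β z s t = NormedSpace.exp (action α β z s t) := rfl

theorem commute_expMat_matA (α β z s t : ℝ) : Commute (expMat α β z s t) (matA α β) := by
  have h : Commute (action α β z s t) (matA α β) :=
    ((matF_comm_matA α β z).smul_left s).add_left ((Commute.refl _).smul_left t)
  exact h.exp_left

theorem transpose_expMat (α β z s t : ℝ) : (expMat α β z s t)ᵀ = expMat α β z s t := by
  rw [expMat_eq, ← Matrix.exp_transpose]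
  congr 1
  ext i j
  fin_cases i <;> fin_cases j <;> simp [action, matF, matA]

theorem expMat_symm (α β z s t : ℝ) : expMat α β z s t 1 0 = expMat α β z s t 0 1 := by
  conv_lhs => rw [← transpose_expMat, Matrix.transpose_apply]

-- All exponents commute, so `exp (L y) = exp (L y - L x) exp (L x)`, and only the derivative of
-- `exp` at `0`, the identity, is needed. The factor `c` is `1` for the invariant frame and `-2` for
-- the fibre metric.
open scoped Matrix.Norms.Operator in
theorem hasFDerivAt_expMat_apply (α β z c : ℝ) (x : Fin 4 → ℝ) (i j : Fin 2) :
    HasFDerivAt (fun y : Fin 4 → ℝ => expMat α β z (c * y 0) (c * y 1) i j)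
      ((c * (matF α β z * expMat α β z (c * x 0) (c * x 1)) i j) •
          (ContinuousLinearMap.proj 0 : (Fin 4 → ℝ) →L[ℝ] ℝ)
        + (c * (matA α β * expMat α β z (c * x 0) (c * x 1)) i j) •
          (ContinuousLinearMap.proj 1 : (Fin 4 → ℝ) →L[ℝ] ℝ)) x := by
  let L : (Fin 4 → ℝ) →L[ℝ] Matrix (Fin 2) (Fin 2) ℝ :=
    (ContinuousLinearMap.proj 0 : (Fin 4 → ℝ) →L[ℝ] ℝ).smulRight (c • matF α β z)
      + (ContinuousLinearMap.proj 1 : (Fin 4 → ℝ) →L[ℝ] ℝ).smulRight (c • matA α β)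
  have h0 : HasFDerivAt (fun y : Fin 4 → ℝ => L y - L x) L x := L.hasFDerivAt.sub_const _
  have h1 : HasFDerivAt (NormedSpace.exp : Matrix (Fin 2) (Fin 2) ℝ → _)
      (1 : Matrix (Fin 2) (Fin 2) ℝ →L[ℝ] Matrix (Fin 2) (Fin 2) ℝ) (L x - L x) := by
    rw [sub_self]
    exact hasFDerivAt_exp_zero
  have h2 := (h1.comp x h0).mul_const' (expMat α β z (c * x 0) (c * x 1))
  have h3 := ((LinearMap.toContinuousLinearMap
    (Matrix.entryLinearMap ℝ ℝ i j)).hasFDerivAt).comp x h2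
  refine (h3.congr_of_eventuallyEq (Filter.Eventually.of_forall fun y => ?_)).congr_fderiv ?_
  · have e1 : L y - L x = action α β z (c * (y 0 - x 0)) (c * (y 1 - x 1)) := by
      simp only [L, action, add_apply, ContinuousLinearMap.smulRight_apply,
        ContinuousLinearMap.proj_apply]
      module
    have e2 : expMat α β z (c * y 0) (c * y 1) = NormedSpace.exp (L y - L x) *
        expMat α β z (c * x 0) (c * x 1) := by
      rw [e1, ← expMat_eq, ← expMat_add]
      congr 1 <;> ring
    simp [e2]
  · ext1 u
    change ((L u) * expMat α β z (c * x 0) (c * x 1)) i j = _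
    simp only [L, add_apply, ContinuousLinearMap.smulRight_apply, ContinuousLinearMap.proj_apply,
      add_mul, smul_mul_assoc, Matrix.add_apply, Matrix.smul_apply, smul_eq_mul,
      smul_apply]
    ring

/-! ### Left translations and left invariant vector fields -/

/-- The differential of the left translation by `x`. -/
def translationDeriv (α β z : ℝ) (x : Fin 4 → ℝ) : (Fin 4 → ℝ) →L[ℝ] (Fin 4 → ℝ) :=
  ContinuousLinearMap.pi ![ContinuousLinearMap.proj 0, ContinuousLinearMap.proj 1,
    expMat α β z (x 0) (x 1) 0 0 • ContinuousLinearMap.proj 2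
      + expMat α β z (x 0) (x 1) 0 1 • ContinuousLinearMap.proj 3,
    expMat α β z (x 0) (x 1) 1 0 • ContinuousLinearMap.proj 2
      + expMat α β z (x 0) (x 1) 1 1 • ContinuousLinearMap.proj 3]

theorem translationDeriv_apply (x v : Fin 4 → ℝ) :
    translationDeriv α β z x v = ![v 0, v 1,
      expMat α β z (x 0) (x 1) 0 0 * v 2 + expMat α β z (x 0) (x 1) 0 1 * v 3,
      expMat α β z (x 0) (x 1) 1 0 * v 2 + expMat α β z (x 0) (x 1) 1 1 * v 3] := by
  funext i
  fin_cases i <;> rfl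

theorem add_translationDeriv (a y : Fin 4 → ℝ) :
    (fun i => a i + translationDeriv α β z a y i) =
      ((show SolvGroup α β z from a) * (show SolvGroup α β z from y) : SolvGroup α β z) := by
  have h : ∀ k, expMat α β z (a 0) (a 1) k 0 * y 2 + expMat α β z (a 0) (a 1) k 1 * y 3 =
      (expMat α β z (a 0) (a 1) *ᵥ ![y 2, y 3]) k := by
    simp [Matrix.mulVec, dotProduct, Fin.sum_univ_two]
  funext i
  fin_cases i
  · rfl
  · rfl
  · exact congrArg (a 2 + ·) (h 0)
  · exact congrArg (a 3 + ·) (h 1)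

/-- In these coordinates left translation by `a` is the affine map `y ↦ a + T y` with `T` the linear
map `translationDeriv α β z a`, so its derivative does not depend on the point. -/
theorem hasMFDerivAt_mul_left (a x : SolvGroup α β z) :
    HasMFDerivAt 𝓘(ℝ, Fin 4 → ℝ) 𝓘(ℝ, Fin 4 → ℝ) (fun y : SolvGroup α β z => a * y) x
      (translationDeriv α β z a) := by
  have h : HasFDerivAt (fun (y : Fin 4 → ℝ) i => a i + translationDeriv α β z a y i)
      (translationDeriv α β z a) x :=
    (translationDeriv α β z a).hasFDerivAt.const_add (fun i => a i)
  have e : (fun (y : Fin 4 → ℝ) i => a i + translationDeriv α β z a y i) =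
      fun y : SolvGroup α β z => a * y := funext (add_translationDeriv a)
  rw [e] at h
  exact hasMFDerivAt_iff_hasFDerivAt.2 h

theorem mfderiv_mul_left (a x : SolvGroup α β z) (u : Fin 4 → ℝ) :
    mfderiv 𝓘(ℝ, Fin 4 → ℝ) 𝓘(ℝ, Fin 4 → ℝ) (fun y : SolvGroup α β z => a * y) x u =
      translationDeriv α β z a u := DFunLike.congr_fun (hasMFDerivAt_mul_left a x).mfderiv u

theorem mulInvariantVectorField_eq (v : LieAlg α β z) (x : SolvGroup α β z) :
    mulInvariantVectorField v x = translationDeriv α β z x v := mfderiv_mul_left x 1 v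

theorem translationDeriv_zero (v : Fin 4 → ℝ) : translationDeriv α β z 0 v = v := by
  funext i
  rw [translationDeriv_apply]
  fin_cases i <;> simp [expMat_zero]

theorem hasFDerivAt_translationDeriv (v : Fin 4 → ℝ) :
    HasFDerivAt (fun x : Fin 4 → ℝ => translationDeriv α β z x v)
      (ContinuousLinearMap.pi ![(0 : (Fin 4 → ℝ) →L[ℝ] ℝ), 0,
        (matF α β z 0 0 * v 2 + matF α β z 0 1 * v 3) • ContinuousLinearMap.proj 0
          + (matA α β 0 0 * v 2 + matA α β 0 1 * v 3) • ContinuousLinearMap.proj 1,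
        (matF α β z 1 0 * v 2 + matF α β z 1 1 * v 3) • ContinuousLinearMap.proj 0
          + (matA α β 1 0 * v 2 + matA α β 1 1 * v 3) • ContinuousLinearMap.proj 1]) 0 := by
  have h1 := fun i j => by simpa [expMat_zero] using hasFDerivAt_expMat_apply α β z 1 0 i j
  rw [hasFDerivAt_pi']
  intro i
  fin_cases i
  · exact hasFDerivAt_const (v 0) _
  · exact hasFDerivAt_const (v 1) _
  · refine (((h1 0 0).mul_const (v 2)).add ((h1 0 1).mul_const (v 3))).congr_fderiv ?_
    ext; simp; ring
  · refine (((h1 1 0).mul_const (v 2)).add ((h1 1 1).mul_const (v 3))).congr_fderiv ?_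
    ext; simp; ring

/-- The Lie bracket in coordinates. -/
def bracketForm (α β z : ℝ) (v w : Fin 4 → ℝ) : Fin 4 → ℝ :=
  ![0, 0, (action α β z (v 0) (v 1) *ᵥ ![w 2, w 3] - action α β z (w 0) (w 1) *ᵥ ![v 2, v 3]) 0,
    (action α β z (v 0) (v 1) *ᵥ ![w 2, w 3] - action α β z (w 0) (w 1) *ᵥ ![v 2, v 3]) 1]

theorem bracket_eq (v w : LieAlg α β z) :
    (⁅v, w⁆ : LieAlg α β z) = bracketForm α β z v w := by
  have hX : ∀ v : LieAlg α β z, mulInvariantVectorField (I := 𝓘(ℝ, Fin 4 → ℝ))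
      (G := SolvGroup α β z) v = fun x => translationDeriv α β z x v := fun v =>
    funext (mulInvariantVectorField_eq v)
  have h1 : (⁅v, w⁆ : LieAlg α β z) = VectorField.lieBracket ℝ
      (fun x : Fin 4 → ℝ => translationDeriv α β z x v)
      (fun x : Fin 4 → ℝ => translationDeriv α β z x w) 0 := by
    rw [GroupLieAlgebra.bracket_def, hX, hX]
    have h := VectorField.mlieBracketWithin_eq_lieBracketWithin (𝕜 := ℝ) (E := Fin 4 → ℝ)
      (V := fun x => translationDeriv α β z x v) (W := fun x => translationDeriv α β z x w)
      (s := Set.univ)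
    rw [VectorField.lieBracketWithin_univ] at h
    have e : (1 : SolvGroup α β z) = (0 : Fin 4 → ℝ) := by
      funext i
      rw [one_def]
      fin_cases i <;> rfl
    rw [e]
    exact congrFun h 0
  have h2 : ∀ v w : Fin 4 → ℝ, VectorField.lieBracket ℝ
      (fun x : Fin 4 → ℝ => translationDeriv α β z x v)
      (fun x : Fin 4 → ℝ => translationDeriv α β z x w) 0 =
        bracketForm α β z v w := by
    intro v w
    rw [VectorField.lieBracket, (hasFDerivAt_translationDeriv w).fderiv,
      (hasFDerivAt_translationDeriv v).fderiv, translationDeriv_zero, translationDeriv_zero]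
    funext i
    fin_cases i <;> simp [action, bracketForm]
    · ring
    · ring
  exact h1.trans (h2 v w)

theorem bracketForm_single (i j : Fin 4) : bracketForm α β z (Pi.single i 1) (Pi.single j 1) =
    match i, j with
    | 0, 2 => (-(z * (2 - 3 * α + α ^ 2 + β ^ 2))) • Pi.single 2 1 + (z * β) • Pi.single 3 1
    | 0, 3 => (z * β) • Pi.single 2 1 + (-(z * (-α + α ^ 2 + β ^ 2))) • Pi.single 3 1
    | 1, 2 => α • Pi.single 2 1 + β • Pi.single 3 1
    | 1, 3 => β • Pi.single 2 1 + (2 - α) • Pi.single 3 1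
    | 2, 0 => -((-(z * (2 - 3 * α + α ^ 2 + β ^ 2))) • Pi.single 2 1 + (z * β) • Pi.single 3 1)
    | 3, 0 => -((z * β) • Pi.single 2 1 + (-(z * (-α + α ^ 2 + β ^ 2))) • Pi.single 3 1)
    | 2, 1 => -(α • Pi.single 2 1 + β • Pi.single 3 1)
    | 3, 1 => -(β • Pi.single 2 1 + (2 - α) • Pi.single 3 1)
    | _, _ => 0 := by
  fin_cases i <;> fin_cases j <;> funext k <;> fin_cases k <;>
    simp [bracketForm, action, matF, matA]

/-- The coframe dual to the frame of left invariant vector fields. -/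
def coframe (α β z : ℝ) (x : Fin 4 → ℝ) : Fin 4 → ((Fin 4 → ℝ) →L[ℝ] ℝ) :=
  ![ContinuousLinearMap.proj 0, ContinuousLinearMap.proj 1,
    expMat α β z (-x 0) (-x 1) 0 0 • ContinuousLinearMap.proj 2
      + expMat α β z (-x 0) (-x 1) 0 1 • ContinuousLinearMap.proj 3,
    expMat α β z (-x 0) (-x 1) 1 0 • ContinuousLinearMap.proj 2
      + expMat α β z (-x 0) (-x 1) 1 1 • ContinuousLinearMap.proj 3]

theorem coframe_apply (x u : Fin 4 → ℝ) (i : Fin 4) :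
    coframe α β z x i u = (![u 0, u 1,
      expMat α β z (-x 0) (-x 1) 0 0 * u 2 + expMat α β z (-x 0) (-x 1) 0 1 * u 3,
      expMat α β z (-x 0) (-x 1) 1 0 * u 2 + expMat α β z (-x 0) (-x 1) 1 1 * u 3] :
        Fin 4 → ℝ) i := by
  fin_cases i <;> rfl

/-- Left invariance of the coframe reduces to `exp (-(a + x)) exp a = exp (-x)` on the fibre. Only
the base coordinates of the points enter. -/
theorem coframe_translationDeriv {a x y : Fin 4 → ℝ} (h0 : y 0 = a 0 + x 0) (h1 : y 1 = a 1 + x 1)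
    (i : Fin 4) (u : Fin 4 → ℝ) :
    coframe α β z y i (translationDeriv α β z a u) = coframe α β z x i u := by
  have h : expMat α β z (-y 0) (-y 1) * expMat α β z (a 0) (a 1) =
      expMat α β z (-x 0) (-x 1) := by
    rw [← expMat_add, h0, h1]
    congr 1 <;> ring
  have h' := fun i j => congrFun (congrFun h i) j
  simp only [Matrix.mul_apply, Fin.sum_univ_two] at h'
  rw [translationDeriv_apply, coframe_apply, coframe_apply]
  fin_cases i
  · simp
  · simp
  · simp [← h']; ring
  · simp [← h']; ring

theorem coframe_frame (x : Fin 4 → ℝ) (i : Fin 4) (u : Fin 4 → ℝ) :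
    coframe α β z x i (translationDeriv α β z x u) = u i := by
  rw [coframe_translationDeriv (x := 0) (by simp) (by simp), coframe_apply]
  fin_cases i <;> simp [expMat_zero]

theorem translationDeriv_surjective (x : Fin 4 → ℝ) :
    Function.Surjective (translationDeriv α β z x) := by
  have hinj : Function.Injective (translationDeriv α β z x).toLinearMap := by
    intro u v huv
    funext i
    rw [← coframe_frame x i u, ← coframe_frame x i v]
    exact congrArg _ huv
  exact LinearMap.injective_iff_surjective.1 hinj

/-- The inner product for which the frame of left invariant vector fields is orthonormal. -/
def innerForm (α β z : ℝ) (x : Fin 4 → ℝ) : (Fin 4 → ℝ) →L[ℝ] (Fin 4 → ℝ) →L[ℝ] ℝ :=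
  ∑ i, (coframe α β z x i).smulRight (coframe α β z x i)

theorem innerForm_apply (x u v : Fin 4 → ℝ) :
    innerForm α β z x u v = ∑ i, coframe α β z x i u * coframe α β z x i v := by
  simp [innerForm]

theorem innerForm_symm (x u v : Fin 4 → ℝ) : innerForm α β z x u v = innerForm α β z x v u := by
  simp only [innerForm_apply, mul_comm]

theorem innerForm_translationDeriv (x : Fin 4 → ℝ) (u v : Fin 4 → ℝ) :
    innerForm α β z x (translationDeriv α β z x u) (translationDeriv α β z x v) =
      ∑ i, u i * v i := by
  simp only [innerForm_apply, coframe_frame]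

theorem innerForm_pos (x : Fin 4 → ℝ) (u : Fin 4 → ℝ) (hu : u ≠ 0) :
    0 < innerForm α β z x u u := by
  obtain ⟨v, rfl⟩ := translationDeriv_surjective (α := α) (β := β) (z := z) x u
  have hv : v ≠ 0 := fun h => hu (by rw [h, map_zero])
  obtain ⟨i, hi⟩ := Function.ne_iff.1 hv
  rw [innerForm_translationDeriv]
  exact Finset.sum_pos' (fun j _ => mul_self_nonneg _) ⟨i, Finset.mem_univ _, mul_self_pos.2 hi⟩

theorem contDiff_innerForm : ContDiff ℝ ∞ (innerForm α β z) := by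
  have he : ∀ i j, ContDiff ℝ ∞ fun x : Fin 4 → ℝ => expMat α β z (-x 0) (-x 1) i j := fun i j =>
    (contMDiff_expMat_apply ∞ α β z i j).contDiff.comp (by fun_prop :
      ContDiff ℝ ∞ fun x : Fin 4 → ℝ => (-x 0, -x 1))
  have hc : ∀ i, ContDiff ℝ ∞ fun x : Fin 4 → ℝ => coframe α β z x i := by
    intro i
    fin_cases i
    · exact contDiff_const
    · exact contDiff_const
    · exact ((he 0 0).smul contDiff_const).add ((he 0 1).smul contDiff_const)
    · exact ((he 1 0).smul contDiff_const).add ((he 1 1).smul contDiff_const)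
  unfold innerForm
  exact ContDiff.sum fun i _ => (hc i).smulRight (hc i)

/-- In the invariant frame the metric is Euclidean, so its unit ball lies in the linear image of the
sup-norm unit ball. -/
theorem isVonNBounded_innerForm (x : Fin 4 → ℝ) :
    Bornology.IsVonNBounded ℝ {v : Fin 4 → ℝ | innerForm α β z x v v < 1} := by
  have hb : Bornology.IsVonNBounded ℝ (translationDeriv α β z x '' Metric.closedBall 0 1) :=
    (NormedSpace.isVonNBounded_closedBall ℝ (Fin 4 → ℝ) 1).image (translationDeriv α β z x)
  refine hb.subset fun u hu => ?_
  obtain ⟨v, rfl⟩ := translationDeriv_surjective (α := α) (β := β) (z := z) x u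
  refine ⟨v, ?_, rfl⟩
  simp only [Set.mem_ofPred_eq, innerForm_translationDeriv] at hu
  rw [mem_closedBall_zero_iff, pi_norm_le_iff_of_nonneg zero_le_one]
  intro i
  have h1 : v i * v i ≤ ∑ j, v j * v j :=
    Finset.single_le_sum (f := fun j => v j * v j) (fun j _ => mul_self_nonneg _) (Finset.mem_univ i)
  rw [Real.norm_eq_abs]
  exact abs_le_one_iff_mul_self_le_one.2 (by linarith)

/-- The left invariant metric for which the standard frame is orthonormal. -/
def leftMetric (α β z : ℝ) : Metric α β z where
  inner x := innerForm α β z x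
  symm x u v := innerForm_symm x u v
  pos x u hu := innerForm_pos x u hu
  isVonNBounded x := isVonNBounded_innerForm x
  contMDiff := contMDiff_bilinearForm contDiff_innerForm

theorem isLeftInvariant_leftMetric : IsLeftInvariant (leftMetric α β z) := by
  intro a x u v
  have h : ∀ {a x y : Fin 4 → ℝ}, y 0 = a 0 + x 0 → y 1 = a 1 + x 1 → ∀ u v : Fin 4 → ℝ,
      innerForm α β z y (translationDeriv α β z a u) (translationDeriv α β z a v) =
        innerForm α β z x u v := fun h0 h1 u v => by
    simp only [innerForm_apply, coframe_translationDeriv h0 h1]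
  exact (congrArg₂ (fun u v : Fin 4 → ℝ => innerForm α β z (a * x) u v) (mfderiv_mul_left a x u)
    (mfderiv_mul_left a x v)).trans (h rfl rfl u v)

theorem leftMetric_frame (x : SolvGroup α β z) (i j : Fin 4) :
    (leftMetric α β z).inner x (mulInvariantVectorField (X α β z i) x)
      (mulInvariantVectorField (X α β z j) x) = if i = j then 1 else 0 := by
  have h : ∑ k, (Pi.single i 1 : Fin 4 → ℝ) k * (Pi.single j 1 : Fin 4 → ℝ) k =
      if i = j then 1 else 0 := by
    simp [Pi.single_apply, eq_comm]
  exact (congrArg₂ (fun u v : Fin 4 → ℝ => innerForm α β z x u v)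
    (mulInvariantVectorField_eq (X α β z i) x) (mulInvariantVectorField_eq (X α β z j) x)).trans
    ((innerForm_translationDeriv x _ _).trans h)

/-- The Lie algebra is not unimodular: `ad X₁` has trace `2`. -/
theorem trace_ad_X_one : LinearMap.trace ℝ (LieAlg α β z)
    (LieAlgebra.ad ℝ (LieAlg α β z) (X α β z 1)) = 2 := by
  let b : Module.Basis (Fin 4) ℝ (LieAlg α β z) := Pi.basisFun ℝ (Fin 4)
  have hb : ∀ i, b.repr (⁅X α β z 1, b i⁆ : LieAlg α β z) i =
      (![0, 0, α, 2 - α] : Fin 4 → ℝ) i := by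
    intro i
    have h1 : b i = X α β z i := Pi.basisFun_apply ℝ (Fin 4) i
    rw [h1, bracket_eq]
    refine (Pi.basisFun_repr (R := ℝ) (η := Fin 4) _ i).trans ?_
    fin_cases i <;> simp [bracketForm, X, action, matA]
  rw [LinearMap.trace_eq_matrix_trace ℝ b, Matrix.trace]
  simp only [Matrix.diag_apply, LinearMap.toMatrix_apply, LieAlgebra.ad_apply, hb]
  simp [Fin.sum_univ_four]

end SolvGroup

/-! ### Completeness of homogeneous Riemannian manifolds -/

namespace RiemMfd

variable {M N : RiemMfd}

open scoped Bundle in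
/-- A map that preserves the metric does not increase the distance. -/
theorem riemDist_map_le {φ : M → N} (hφ : ContMDiff 𝓘(ℝ, M.E) 𝓘(ℝ, N.E) 1 φ)
    (hiso : ∀ (x : M) (u : M.T x), N.g (φ x) (mfderiv 𝓘(ℝ, M.E) 𝓘(ℝ, N.E) φ x u)
      (mfderiv 𝓘(ℝ, M.E) 𝓘(ℝ, N.E) φ x u) = M.g x u u) (x y : M) :
    N.riemDist (φ x) (φ y) ≤ M.riemDist x y := by
  let _ : Bundle.RiemannianBundle (fun x : M => TangentSpace 𝓘(ℝ, M.E) x) :=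
    ⟨M.metric.toRiemannianMetric⟩
  let _ : Bundle.RiemannianBundle (fun x : N => TangentSpace 𝓘(ℝ, N.E) x) :=
    ⟨N.metric.toRiemannianMetric⟩
  refine le_of_forall_gt fun r hr => ?_
  change Manifold.riemannianEDist 𝓘(ℝ, M.E) x y < r at hr
  obtain ⟨γ, h0, h1, hγ, hlen⟩ := Manifold.exists_lt_of_riemannianEDist_lt hr
  have hγ' : ContMDiffOn 𝓘(ℝ, ℝ) 𝓘(ℝ, N.E) 1 (φ ∘ γ) (Set.Icc 0 1) := hφ.comp_contMDiffOn hγ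
  have hn : ∀ (x : M) (u : M.T x), ‖mfderiv 𝓘(ℝ, M.E) 𝓘(ℝ, N.E) φ x u‖ₑ = ‖u‖ₑ := by
    intro x u
    rw [enorm_eq_iff_norm_eq, norm_eq_sqrt_real_inner, norm_eq_sqrt_real_inner]
    exact congrArg Real.sqrt (hiso x u)
  change Manifold.riemannianEDist 𝓘(ℝ, N.E) (φ x) (φ y) < r
  refine lt_of_le_of_lt ?_ hlen
  refine (Manifold.riemannianEDist_le_pathELength hγ' (by simp [h0]) (by simp [h1])
    zero_le_one).trans_eq ?_
  rw [Manifold.pathELength_eq_lintegral_mfderivWithin_Icc,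
    Manifold.pathELength_eq_lintegral_mfderivWithin_Icc]
  refine MeasureTheory.setLIntegral_congr_fun measurableSet_Icc fun t ht => ?_
  have hu : UniqueMDiffWithinAt 𝓘(ℝ, ℝ) (Set.Icc (0 : ℝ) 1) t :=
    (uniqueDiffOn_Icc zero_lt_one t ht).uniqueMDiffWithinAt
  have hc := mfderiv_comp_mfderivWithin t (hφ.mdifferentiableAt (by simp))
    ((hγ.mdifferentiableOn (by simp)) t ht) hu
  have hc' := DFunLike.congr_fun hc (1 : ℝ)
  refine (congrArg (fun v : N.T (φ (γ t)) => ‖v‖ₑ) hc').trans ?_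
  exact hn (γ t) _

open scoped Bundle in
theorem riemDist_triangle (x y z : M) : M.riemDist x z ≤ M.riemDist x y + M.riemDist y z :=
  let _ : Bundle.RiemannianBundle (fun x : M => TangentSpace 𝓘(ℝ, M.E) x) :=
    ⟨M.metric.toRiemannianMetric⟩
  Manifold.riemannianEDist_triangle

open scoped Bundle in
theorem eventually_riemDist_lt (x : M) {c : ℝ≥0∞} (hc : 0 < c) :
    ∀ᶠ y in 𝓝 x, M.riemDist x y < c :=
  let _ : Bundle.RiemannianBundle (fun x : M => TangentSpace 𝓘(ℝ, M.E) x) :=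
    ⟨M.metric.toRiemannianMetric⟩
  have : IsManifold 𝓘(ℝ, M.E) 1 M := IsManifold.of_le (n := ∞) ENat.LEInfty.out
  have : IsContinuousRiemannianBundle M.E (fun x : M => TangentSpace 𝓘(ℝ, M.E) x) :=
    ⟨⟨M.metric.inner, M.metric.contMDiff.continuous, fun _ _ _ => rfl⟩⟩
  eventually_riemannianEDist_lt 𝓘(ℝ, M.E) x hc

theorem locallyCompactSpace (M : RiemMfd) : LocallyCompactSpace M :=
  ChartedSpace.locallyCompactSpace M.E M

open scoped Bundle in
theorem exists_riemDist_lt_subset {x : M} {s : Set M} (hs : s ∈ 𝓝 x) :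
    ∃ c > 0, ∀ y, M.riemDist x y < c → y ∈ s :=
  let _ : Bundle.RiemannianBundle (fun x : M => TangentSpace 𝓘(ℝ, M.E) x) :=
    ⟨M.metric.toRiemannianMetric⟩
  have : IsManifold 𝓘(ℝ, M.E) 1 M := IsManifold.of_le (n := ∞) ENat.LEInfty.out
  have : IsContinuousRiemannianBundle M.E (fun x : M => TangentSpace 𝓘(ℝ, M.E) x) :=
    ⟨⟨M.metric.inner, M.metric.contMDiff.continuous, fun _ _ _ => rfl⟩⟩
  have := M.locallyCompactSpace
  setOfPred_riemannianEDist_lt_subset_nhds' 𝓘(ℝ, M.E) hs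

/-- A Riemannian manifold with a transitive group of isometries is complete. -/
theorem isComplete_of_transitive (o : M) (τ : M → M ≃ₜ M) (hτ : ∀ x, τ x o = x)
    (hdist : ∀ x y z, M.riemDist ((τ x).symm y) ((τ x).symm z) ≤ M.riemDist y z) :
    M.IsComplete := by
  intro u hu
  have := M.locallyCompactSpace
  obtain ⟨K, hK, hKo⟩ := exists_compact_mem_nhds o
  obtain ⟨c, hc, hcK⟩ := exists_riemDist_lt_subset hKo
  obtain ⟨n, hn⟩ := hu c hc
  -- One compact neighbourhood `K` of `o` contains a metric ball of radius `c`. The isometry taking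
  -- `o` to `u n` carries it to a compact set that contains the whole tail of the Cauchy sequence.
  have hmem : ∀ i, u (i + n) ∈ τ (u n) '' K := by
    intro i
    refine ⟨(τ (u n)).symm (u (i + n)), hcK _ ?_, by simp⟩
    have h1 := hdist (u n) (u n) (u (i + n))
    have h2 : (τ (u n)).symm (u n) = o := by
      rw [Homeomorph.symm_apply_eq, hτ]
    rw [h2] at h1
    exact h1.trans_lt (hn _ le_rfl _ (by omega))
  have : FirstCountableTopology M := inferInstance
  obtain ⟨x, -, φ, hφ, hx⟩ := (hK.image (τ (u n)).continuous).tendsto_subseq hmem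
  refine ⟨x, fun s hs => ?_⟩
  obtain ⟨ε, hε, hεs⟩ := exists_riemDist_lt_subset hs
  have hε2 : 0 < ε / 2 := ENNReal.half_pos hε.ne'
  obtain ⟨k, hk⟩ := hu (ε / 2) hε2
  obtain ⟨j, hj, hjk⟩ := ((hx.eventually (eventually_riemDist_lt x hε2)).and
    (Filter.eventually_ge_atTop k)).exists
  refine Filter.mem_map.2 ((Filter.eventually_ge_atTop k).mono fun i hi => ?_)
  refine hεs _ ((riemDist_triangle x (u (φ j + n)) (u i)).trans_lt ?_)
  rw [← ENNReal.add_halves ε]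
  exact ENNReal.add_lt_add hj (hk _ (by have := hφ.id_le j; simp at this; omega) _ hi)

end RiemMfd

/-! ### Completeness of left-invariant metrics -/

namespace SolvGroup

variable {α β z : ℝ}

/-- A left invariant metric is complete. -/
theorem isComplete_of_isLeftInvariant {γ : Metric α β z} (hγ : IsLeftInvariant γ) :
    (toRiemMfd γ).IsComplete := by
  have hle : ∀ a x y : SolvGroup α β z,
      (toRiemMfd γ).riemDist (a * x) (a * y) ≤ (toRiemMfd γ).riemDist x y := fun a x y =>
    RiemMfd.riemDist_map_le (M := toRiemMfd γ) (N := toRiemMfd γ)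
      (φ := fun x : SolvGroup α β z => a * x)
      (contMDiff_mul_left (I := 𝓘(ℝ, Fin 4 → ℝ)) (G := SolvGroup α β z) (n := 1) (a := a))
      (fun x u => hγ a x u u) x y
  have : ContinuousMul (SolvGroup α β z) :=
    continuousMul_of_contMDiffMul 𝓘(ℝ, Fin 4 → ℝ) ∞
  refine RiemMfd.isComplete_of_transitive (M := toRiemMfd γ) (1 : SolvGroup α β z)
    (fun a : SolvGroup α β z => (Homeomorph.mulLeft a : SolvGroup α β z ≃ₜ SolvGroup α β z))
    (fun a => mul_one (M := SolvGroup α β z) a) fun a x y => hle _ x y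

end SolvGroup

/-! ### Metric traces as traces of endomorphisms -/

namespace Coord

variable {E : Type} [NormedAddCommGroup E] [NormedSpace ℝ E] [FiniteDimensional ℝ E]

/-- By symmetry, pairing `T (b i)` with the dual vector `e^i` gives the `i`-th coordinate of `T (b
i)`, a diagonal entry of `T`. -/
theorem metricTrace_eq_trace {G : E →L[ℝ] E →L[ℝ] ℝ} (hs : ∀ u v, G u v = G v u)
    (hG : ∀ u, u ≠ 0 → 0 < G u u) {B : E → E → ℝ} {T : E →ₗ[ℝ] E}
    (hT : ∀ u v, B u v = G (T u) v) : metricTrace G B = LinearMap.trace ℝ E T := by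
  rw [LinearMap.trace_eq_matrix_trace ℝ (Module.finBasis ℝ E), Matrix.trace, metricTrace]
  refine Finset.sum_congr rfl fun i _ => ?_
  rw [hT, hs, apply_sharp hG]
  simp [LinearMap.toMatrix_apply]

end Coord

/-! ### Curvature, the warping function and failure of rigidity -/

namespace SolvGroup

variable {α β z : ℝ}

/-- The matrix of the metric on the fibre `ℝ²`. -/
def fibreMetric (α β z : ℝ) (x : Fin 4 → ℝ) : Matrix (Fin 2) (Fin 2) ℝ :=
  expMat α β z (-2 * x 0) (-2 * x 1)

theorem fibreMetric_eq_mul (x : Fin 4 → ℝ) : fibreMetric α β z x =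
    expMat α β z (-x 0) (-x 1) * expMat α β z (-x 0) (-x 1) := by
  rw [← expMat_add, fibreMetric]
  congr 1 <;> ring

/-- The fibre part is `EᵀE` with `E = exp (-(x₀F + x₁A))`; as `E` is symmetric, this is `E²`. -/
theorem innerForm_eq (x u v : Fin 4 → ℝ) : innerForm α β z x u v =
    u 0 * v 0 + u 1 * v 1 + fibreMetric α β z x 0 0 * u 2 * v 2
      + fibreMetric α β z x 0 1 * (u 2 * v 3 + u 3 * v 2)
      + fibreMetric α β z x 1 1 * u 3 * v 3 := by
  rw [innerForm_apply, fibreMetric_eq_mul]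
  simp only [coframe_apply, Fin.sum_univ_four, Matrix.mul_apply, Fin.sum_univ_two,
    expMat_symm α β z]
  simp
  ring

/-- The fibre metric commutes with `A`, which is not scalar because `β ≠ 0`, so it has the form `a +
bA`. This turns the later identities involving the exponential into polynomial identities in `a, b`.
-/
theorem exists_fibreMetric_eq (hβ : β ≠ 0) (x : Fin 4 → ℝ) : ∃ a b : ℝ,
    fibreMetric α β z x = !![a + b * α, b * β; b * β, a + b * (2 - α)] := by
  have h := congrFun (congrFun (commute_expMat_matA α β z (-2 * x 0) (-2 * x 1)).eq 0) 1
  have hs := expMat_symm α β z (-2 * x 0) (-2 * x 1)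
  rw [fibreMetric]
  generalize expMat α β z (-2 * x 0) (-2 * x 1) = P at *
  simp only [Matrix.mul_apply, Fin.sum_univ_two, matA, Matrix.of_apply, Matrix.cons_val',
    Matrix.cons_val_zero, Matrix.cons_val_one, Matrix.cons_val_fin_one] at h
  -- The off-diagonal entry determines `b`, and then the upper left entry determines `a`. The lower
  -- right entry is where commutation with `A` is used.
  refine ⟨P 0 0 - P 0 1 / β * α, P 0 1 / β, ?_⟩
  ext i j
  fin_cases i <;> fin_cases j
  · simp
  · simp [hβ]
  · simp [hβ, hs]
  · simp
    field_simp
    linear_combination -h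

/-- The derivative of the metric of the fibre. -/
def fibreMetricDeriv (α β z : ℝ) (P : Matrix (Fin 2) (Fin 2) ℝ) (u : Fin 4 → ℝ) :
    Matrix (Fin 2) (Fin 2) ℝ := -2 • (action α β z (u 0) (u 1) * P)

theorem hasFDerivAt_fibreMetric (x : Fin 4 → ℝ) (i j : Fin 2) : ∃ L : (Fin 4 → ℝ) →L[ℝ] ℝ,
    HasFDerivAt (fun y => fibreMetric α β z y i j) L x ∧
      ∀ u, L u = fibreMetricDeriv α β z (fibreMetric α β z x) u i j := by
  refine ⟨_, hasFDerivAt_expMat_apply α β z (-2) x i j, fun u => ?_⟩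
  simp [fibreMetricDeriv, action, fibreMetric, add_mul]
  ring

theorem fderiv_innerForm_apply (x u v : Fin 4 → ℝ) (w : Fin 4 → ℝ) :
    fderiv ℝ (innerForm α β z) x w u v =
      fibreMetricDeriv α β z (fibreMetric α β z x) w 0 0 * u 2 * v 2
      + fibreMetricDeriv α β z (fibreMetric α β z x) w 0 1 * (u 2 * v 3 + u 3 * v 2)
      + fibreMetricDeriv α β z (fibreMetric α β z x) w 1 1 * u 3 * v 3 := by
  have hd : DifferentiableAt ℝ (innerForm α β z) x :=
    contDiff_innerForm.differentiable (by simp) x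
  have e : fderiv ℝ (fun x => innerForm α β z x u v) x w = fderiv ℝ (innerForm α β z) x w u v := by
    rw [((hd.hasFDerivAt.clm_apply (hasFDerivAt_const u x)).clm_apply
      (hasFDerivAt_const v x)).fderiv]
    simp
  rw [← e]
  obtain ⟨L0, h0, e0⟩ := hasFDerivAt_fibreMetric (α := α) (β := β) (z := z) x 0 0
  obtain ⟨L1, h1, e1⟩ := hasFDerivAt_fibreMetric (α := α) (β := β) (z := z) x 0 1
  obtain ⟨L2, h2, e2⟩ := hasFDerivAt_fibreMetric (α := α) (β := β) (z := z) x 1 1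
  have h := ((((h0.mul_const (u 2)).mul_const (v 2)).add
    (h1.mul_const (u 2 * v 3 + u 3 * v 2))).add ((h2.mul_const (u 3)).mul_const (v 3))).const_add
    (u 0 * v 0 + u 1 * v 1)
  have e' : (fun x => innerForm α β z x u v) = _ := funext fun x =>
    (innerForm_eq x u v).trans (by ring :
      _ = u 0 * v 0 + u 1 * v 1 + (fibreMetric α β z x 0 0 * u 2 * v 2
      + fibreMetric α β z x 0 1 * (u 2 * v 3 + u 3 * v 2)
      + fibreMetric α β z x 1 1 * u 3 * v 3))
  rw [e']
  erw [h.fderiv]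
  simp [e0, e1, e2]
  ring

/-- The Christoffel symbols, in terms of the metric `P` of the fibre. -/
def christoffelForm (α β z : ℝ) (P : Matrix (Fin 2) (Fin 2) ℝ) (u v : Fin 4 → ℝ) : Fin 4 → ℝ :=
  ![∑ i, ∑ j, (matF α β z *ᵥ ![u 2, u 3]) i * P i j * (![v 2, v 3] : Fin 2 → ℝ) j,
    ∑ i, ∑ j, (matA α β *ᵥ ![u 2, u 3]) i * P i j * (![v 2, v 3] : Fin 2 → ℝ) j,
    -(action α β z (u 0) (u 1) *ᵥ ![v 2, v 3] + action α β z (v 0) (v 1) *ᵥ ![u 2, u 3]) 0,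
    -(action α β z (u 0) (u 1) *ᵥ ![v 2, v 3] + action α β z (v 0) (v 1) *ᵥ ![u 2, u 3]) 1]

/-- The form to be checked comes from `∇_u v = ⟨F u, v⟩ X₀ + ⟨A u, v⟩ X₁` for fibre coordinate
vectors, and from the base acting on the fibre through `-F` and `-A`, half the logarithmic
derivative of `P`. -/
theorem christoffel_innerForm (hβ : β ≠ 0) (x u v : Fin 4 → ℝ) :
    Coord.christoffel (innerForm α β z) x u v =
      christoffelForm α β z (fibreMetric α β z x) u v := by
  refine Coord.christoffel_eq (innerForm_pos x) fun w => ?_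
  rw [innerForm_eq, fderiv_innerForm_apply, fderiv_innerForm_apply, fderiv_innerForm_apply]
  obtain ⟨a, b, hP⟩ := exists_fibreMetric_eq (α := α) (z := z) hβ x
  rw [hP]
  simp [christoffelForm, fibreMetricDeriv, action, matF, matA, Matrix.mulVec, dotProduct,
    Fin.sum_univ_two]
  ring

theorem fderiv_christoffel_innerForm (hβ : β ≠ 0) (x u v w : Fin 4 → ℝ) :
    fderiv ℝ (fun y => Coord.christoffel (innerForm α β z) y v w) x u =
      ![∑ i, ∑ j, (matF α β z *ᵥ ![v 2, v 3]) i *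
          fibreMetricDeriv α β z (fibreMetric α β z x) u i j * (![w 2, w 3] : Fin 2 → ℝ) j,
        ∑ i, ∑ j, (matA α β *ᵥ ![v 2, v 3]) i *
          fibreMetricDeriv α β z (fibreMetric α β z x) u i j * (![w 2, w 3] : Fin 2 → ℝ) j,
        0, 0] := by
  choose L hL hLu using fun i j => hasFDerivAt_fibreMetric (α := α) (β := β) (z := z) x i j
  simp only [christoffel_innerForm hβ]
  have h (c d : Fin 2 → ℝ) : HasFDerivAt (fun y => ∑ i, ∑ j, c i * fibreMetric α β z y i j * d j)
      (∑ i, ∑ j, d j • c i • L i j) x :=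
    HasFDerivAt.fun_sum fun i _ => HasFDerivAt.fun_sum fun j _ =>
      ((hL i j).const_mul (c i)).mul_const (d j)
  have h' : HasFDerivAt (fun y => christoffelForm α β z (fibreMetric α β z y) v w)
      (ContinuousLinearMap.pi ![∑ i, ∑ j, (![w 2, w 3] : Fin 2 → ℝ) j •
          (matF α β z *ᵥ ![v 2, v 3]) i • L i j,
        ∑ i, ∑ j, (![w 2, w 3] : Fin 2 → ℝ) j • (matA α β *ᵥ ![v 2, v 3]) i • L i j, 0, 0]) x := by
    rw [hasFDerivAt_pi']
    intro i
    fin_cases i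
    · exact h _ _
    · exact h _ _
    · exact hasFDerivAt_const _ _
    · exact hasFDerivAt_const _ _
  rw [h'.fderiv]
  funext i
  fin_cases i
  · simp [Fin.sum_univ_two, hLu]; ring
  · simp [Fin.sum_univ_two, hLu]; ring
  · simp
  · simp

theorem isMetricAt_innerForm (x : Fin 4 → ℝ) : Coord.IsMetricAt (innerForm α β z) x where
  contDiffAt := contDiff_innerForm.contDiffAt.of_le ENat.LEInfty.out
  symm := Filter.Eventually.of_forall innerForm_symm
  pos := Filter.Eventually.of_forall innerForm_pos

/-- Half the trace of `A ^ 2`. -/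
def rho (α β : ℝ) : ℝ := 2 - 2 * α + α ^ 2 + β ^ 2

/-- The Ricci operator. -/
def ricciOp (α β z : ℝ) : (Fin 4 → ℝ) →ₗ[ℝ] (Fin 4 → ℝ) :=
  Matrix.toLin' !![-2 * z ^ 2 * (rho α β - 1) * rho α β, 0, 0, 0;
    0, -2 * rho α β, 0, 0;
    0, 0, -2 * ((1 - z ^ 2 * (rho α β - 1)) * α + z ^ 2 * (rho α β - 1) * rho α β),
      -2 * (1 - z ^ 2 * (rho α β - 1)) * β;
    0, 0, -2 * (1 - z ^ 2 * (rho α β - 1)) * β,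
      -2 * ((1 - z ^ 2 * (rho α β - 1)) * (2 - α) + z ^ 2 * (rho α β - 1) * rho α β)]

theorem ricciOp_apply (u : Fin 4 → ℝ) : ricciOp α β z u =
    ![-2 * z ^ 2 * (rho α β - 1) * rho α β * u 0, -2 * rho α β * u 1,
      -2 * ((1 - z ^ 2 * (rho α β - 1)) * α + z ^ 2 * (rho α β - 1) * rho α β) * u 2
        + -2 * (1 - z ^ 2 * (rho α β - 1)) * β * u 3,
      -2 * (1 - z ^ 2 * (rho α β - 1)) * β * u 2
        + -2 * ((1 - z ^ 2 * (rho α β - 1)) * (2 - α) + z ^ 2 * (rho α β - 1) * rho α β) * u 3] := by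
  funext i
  fin_cases i <;> simp [ricciOp, Matrix.mulVec, dotProduct, Fin.sum_univ_four]

theorem riemann_innerForm (hβ : β ≠ 0) (x u v w : Fin 4 → ℝ) :
    Coord.riemann (innerForm α β z) x u v w =
      ![∑ i, ∑ j, (matF α β z *ᵥ ![v 2, v 3]) i *
          fibreMetricDeriv α β z (fibreMetric α β z x) u i j * (![w 2, w 3] : Fin 2 → ℝ) j
        - ∑ i, ∑ j, (matF α β z *ᵥ ![u 2, u 3]) i *
          fibreMetricDeriv α β z (fibreMetric α β z x) v i j * (![w 2, w 3] : Fin 2 → ℝ) j,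
        ∑ i, ∑ j, (matA α β *ᵥ ![v 2, v 3]) i *
          fibreMetricDeriv α β z (fibreMetric α β z x) u i j * (![w 2, w 3] : Fin 2 → ℝ) j
        - ∑ i, ∑ j, (matA α β *ᵥ ![u 2, u 3]) i *
          fibreMetricDeriv α β z (fibreMetric α β z x) v i j * (![w 2, w 3] : Fin 2 → ℝ) j,
        0, 0]
      + christoffelForm α β z (fibreMetric α β z x) u
        (christoffelForm α β z (fibreMetric α β z x) v w)
      - christoffelForm α β z (fibreMetric α β z x) v
        (christoffelForm α β z (fibreMetric α β z x) u w) := by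
  rw [Coord.riemann, fderiv_christoffel_innerForm hβ, fderiv_christoffel_innerForm hβ]
  simp only [christoffel_innerForm hβ]
  congr 2
  funext i
  fin_cases i
  · rfl
  · rfl
  · exact sub_zero _
  · exact sub_zero _

/-- The trace is taken in the standard coordinate basis. Writing `P = a + bA` makes the result a
polynomial identity in which `P` survives only through the inner product. -/
theorem ricci_innerForm (hβ : β ≠ 0) (x u v : Fin 4 → ℝ) :
    Coord.ricci (innerForm α β z) x u v = innerForm α β z x (ricciOp α β z u) v := by
  rw [(isMetricAt_innerForm x).ricci_eq, LinearMap.trace_eq_matrix_trace ℝ (Pi.basisFun ℝ (Fin 4)),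
    Matrix.trace]
  simp only [Matrix.diag_apply, LinearMap.toMatrix_apply, Pi.basisFun_repr, Pi.basisFun_apply]
  change ∑ i, Coord.riemann (innerForm α β z) x (Pi.single i 1) u v i = _
  simp only [riemann_innerForm hβ]
  rw [innerForm_eq, ricciOp_apply]
  obtain ⟨a, b, hP⟩ := exists_fibreMetric_eq (α := α) (z := z) hβ x
  rw [hP]
  simp [christoffelForm, fibreMetricDeriv, action, matF, matA, Matrix.mulVec, dotProduct,
    Fin.sum_univ_two, Fin.sum_univ_four, rho]
  ring

theorem one_lt_rho (hβ : β ≠ 0) : 1 < rho α β := by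
  have : 0 < β ^ 2 := by positivity
  rw [rho]
  nlinarith [sq_nonneg (α - 1)]

/-- Every preferred chart of the group is the identity of `ℝ⁴`, so one global expression serves at
all points. -/
theorem coordMetric_leftMetric (p : SolvGroup α β z) :
    (toRiemMfd (leftMetric α β z)).coordMetric p = innerForm α β z := by
  have h : ∀ (y q : Fin 4 → ℝ) (A : (Fin 4 → ℝ) →L[ℝ] (Fin 4 → ℝ)), q = y →
      A = ContinuousLinearMap.id ℝ _ → (innerForm α β z q).bilinearComp A A = innerForm α β z y := by
    rintro y _ _ rfl rfl
    rfl
  have hs : ∀ p y : Fin 4 → ℝ, (extChartAt 𝓘(ℝ, Fin 4 → ℝ) p).symm y = y := by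
    intro p y
    rw [extChartAt_model_space_eq_id]
    rfl
  have hd : ∀ p y : Fin 4 → ℝ, HasFDerivAt (extChartAt 𝓘(ℝ, Fin 4 → ℝ) p).symm
      (ContinuousLinearMap.id ℝ (Fin 4 → ℝ)) y := fun p y =>
    (hasFDerivAt_id y).congr_of_eventuallyEq (Filter.Eventually.of_forall (hs p))
  exact funext fun y => h y _ _ (hs p y) (hasMFDerivAt_iff_hasFDerivAt.2 (hd p y)).mfderiv

theorem ricci_leftMetric (hβ : β ≠ 0) (p : SolvGroup α β z) (u v : Fin 4 → ℝ) :
    (toRiemMfd (leftMetric α β z)).ricci p u v = innerForm α β z p (ricciOp α β z u) v :=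
  (congrArg (fun h => Coord.ricci (E := Fin 4 → ℝ) h p u v) (coordMetric_leftMetric p)).trans
    (ricci_innerForm hβ p u v)

theorem scal_leftMetric (hβ : β ≠ 0) (p : SolvGroup α β z) :
    (toRiemMfd (leftMetric α β z)).scal p =
      LinearMap.trace ℝ (Fin 4 → ℝ) (ricciOp α β z) :=
  Coord.metricTrace_eq_trace (E := Fin 4 → ℝ) (innerForm_symm p) (innerForm_pos p) (ricci_leftMetric hβ p)

/-- The warping function. -/
def weight (α β z : ℝ) (x : Fin 4 → ℝ) : ℝ := Real.exp (rho α β * z * x 0)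

theorem hasFDerivAt_weight (x : Fin 4 → ℝ) : HasFDerivAt (weight α β z)
    ((weight α β z x * (rho α β * z)) • (ContinuousLinearMap.proj 0 : (Fin 4 → ℝ) →L[ℝ] ℝ)) x := by
  have h := (((ContinuousLinearMap.proj 0 : (Fin 4 → ℝ) →L[ℝ] ℝ).hasFDerivAt (x := x)).const_mul
    (rho α β * z)).exp
  refine h.congr_fderiv ?_
  rw [smul_smul]
  rfl

/-- The endomorphism corresponding to the Hessian of the warping function, divided by this
function. -/
def hessOp (α β z : ℝ) : (Fin 4 → ℝ) →ₗ[ℝ] (Fin 4 → ℝ) :=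
  Matrix.toLin' !![rho α β ^ 2 * z ^ 2, 0, 0, 0; 0, 0, 0, 0;
    0, 0, -rho α β * z * matF α β z 0 0, -rho α β * z * matF α β z 0 1;
    0, 0, -rho α β * z * matF α β z 1 0, -rho α β * z * matF α β z 1 1]

theorem hessOp_apply (u : Fin 4 → ℝ) : hessOp α β z u =
    ![rho α β ^ 2 * z ^ 2 * u 0, 0,
      -rho α β * z * matF α β z 0 0 * u 2 + -rho α β * z * matF α β z 0 1 * u 3,
      -rho α β * z * matF α β z 1 0 * u 2 + -rho α β * z * matF α β z 1 1 * u 3] := by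
  funext i
  fin_cases i <;> simp [hessOp, Matrix.mulVec, dotProduct, Fin.sum_univ_four]

theorem trace_hessOp : LinearMap.trace ℝ _ (hessOp α β z) =
    rho α β ^ 2 * z ^ 2 + 2 * rho α β * z ^ 2 * (rho α β - 1) := by
  rw [hessOp, Matrix.trace_toLin'_eq]
  simp [Matrix.trace, Fin.sum_univ_four, matF, rho]
  ring

/-- Since `F = z (A - ρ)`, both sides vanish on `X₁` and are multiples of `A - ρ` on the fibre. The
fibre blocks and the `X₀` entries agree by the one relation `hm`, a rearrangement of the condition
on `z`. -/
theorem smul_hessOp {m : ℝ} (hz : z ^ 2 * (m * rho α β + 2 * rho α β - 2) = 2) (u : Fin 4 → ℝ) :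
    m • hessOp α β z u = ricciOp α β z u - (-2 * rho α β) • u := by
  have hm : m * (rho α β * z ^ 2) = 2 - 2 * z ^ 2 * (rho α β - 1) := by linarith
  rw [hessOp_apply, ricciOp_apply]
  funext i
  fin_cases i
  · simp
    linear_combination (rho α β * u 0) * hm
  · simp
  · simp [matF]
    have e : rho α β = 2 - 2 * α + α ^ 2 + β ^ 2 := rfl
    linear_combination ((rho α β - α) * u 2 - β * u 3) * hm - m * rho α β * z ^ 2 * u 2 * e
  · simp [matF]
    have e : rho α β = 2 - 2 * α + α ^ 2 + β ^ 2 := rfl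
    linear_combination ((rho α β - 2 + α) * u 3 - β * u 2) * hm - m * rho α β * z ^ 2 * u 3 * e

theorem hess_innerForm (hβ : β ≠ 0) (x u v : Fin 4 → ℝ) :
    Coord.hess (innerForm α β z) (weight α β z) x u v =
      innerForm α β z x ((weight α β z x • hessOp α β z) u) v := by
  have h : HasFDerivAt (fun y => fderiv ℝ (weight α β z) y v)
      ((rho α β * z * v 0) • (weight α β z x * (rho α β * z)) •
        (ContinuousLinearMap.proj 0 : (Fin 4 → ℝ) →L[ℝ] ℝ)) x := by
    refine ((hasFDerivAt_weight x).const_mul (rho α β * z * v 0)).congr_of_eventuallyEq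
      (Filter.Eventually.of_forall fun y => ?_)
    beta_reduce
    rw [(hasFDerivAt_weight y).fderiv]
    simp
    ring
  rw [Coord.hess, h.fderiv, (hasFDerivAt_weight x).fderiv, christoffel_innerForm hβ, innerForm_eq,
    LinearMap.smul_apply, hessOp_apply]
  obtain ⟨a, b, hP⟩ := exists_fibreMetric_eq (α := α) (z := z) hβ x
  rw [hP]
  simp [christoffelForm, matF, Matrix.mulVec, dotProduct, Fin.sum_univ_two]
  ring

theorem hess_leftMetric (hβ : β ≠ 0) (p : SolvGroup α β z) (u v : Fin 4 → ℝ) :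
    (toRiemMfd (leftMetric α β z)).hess (weight α β z) p u v =
      innerForm α β z p ((weight α β z p • hessOp α β z) u) v :=
  (congrArg (fun h => Coord.hess h (weight α β z) p u v) (coordMetric_leftMetric p)).trans
    (hess_innerForm hβ p u v)

theorem laplacian_leftMetric (hβ : β ≠ 0) (p : SolvGroup α β z) :
    (toRiemMfd (leftMetric α β z)).laplacian (weight α β z) p =
      weight α β z p * (rho α β ^ 2 * z ^ 2 + 2 * rho α β * z ^ 2 * (rho α β - 1)) :=
  (Coord.metricTrace_eq_trace (innerForm_symm p) (innerForm_pos p) (hess_leftMetric hβ p)).trans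
    (by rw [map_smul, trace_hessOp, smul_eq_mul])

theorem grad_leftMetric (p : SolvGroup α β z) :
    (toRiemMfd (leftMetric α β z)).grad (weight α β z) p =
      (![weight α β z p * (rho α β * z), 0, 0, 0] : Fin 4 → ℝ) := by
  have e : mfderiv 𝓘(ℝ, Fin 4 → ℝ) 𝓘(ℝ, ℝ) (weight α β z) p =
      (weight α β z p * (rho α β * z)) • (ContinuousLinearMap.proj 0 : (Fin 4 → ℝ) →L[ℝ] ℝ) :=
    (hasMFDerivAt_iff_hasFDerivAt.2 (hasFDerivAt_weight p)).mfderiv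
  refine (congrArg (Coord.sharp (innerForm α β z p)) e).trans ?_
  have h : ∀ x w : Fin 4 → ℝ, innerForm α β z x ![weight α β z x * (rho α β * z), 0, 0, 0] w =
      ((weight α β z x * (rho α β * z)) • (ContinuousLinearMap.proj 0 : (Fin 4 → ℝ) →L[ℝ] ℝ)) w := by
    intro x w
    rw [innerForm_eq]
    simp
  exact Coord.sharp_eq (innerForm_pos p) (h p)

theorem mu_leftMetric {m : ℝ} (hβ : β ≠ 0) (hz : z ^ 2 * (m * rho α β + 2 * rho α β - 2) = 2)
    (p : SolvGroup α β z) :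
    (toRiemMfd (leftMetric α β z)).mu (-2 * rho α β) m (weight α β z) p = 0 := by
  have hg : (toRiemMfd (leftMetric α β z)).g p
      ((toRiemMfd (leftMetric α β z)).grad (weight α β z) p)
      ((toRiemMfd (leftMetric α β z)).grad (weight α β z) p) =
      (weight α β z p * (rho α β * z)) ^ 2 :=
    ((toRiemMfd (leftMetric α β z)).g_congr (grad_leftMetric p) (grad_leftMetric p)).trans
      ((innerForm_eq p _ _).trans (by simp [sq]))
  have h := (congrArg₂ (fun a b => weight α β z p * a + (m - 1) * b
    + -2 * rho α β * weight α β z p ^ 2) (laplacian_leftMetric hβ p) hg)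
  refine h.trans ?_
  -- The sum is `w² ρ (z² (mρ + 2ρ - 2) - 2)`, which the condition on `z` annihilates.
  linear_combination (weight α β z p ^ 2 * rho α β) * hz

theorem isQuasiEinstein_leftMetric {m : ℝ} (hm : 0 < m) (hβ : β ≠ 0)
    (hz : z ^ 2 * (m * rho α β + 2 * rho α β - 2) = 2) :
    (toRiemMfd (leftMetric α β z)).IsQuasiEinstein (-2 * rho α β) m (weight α β z) where
  complete := isComplete_of_isLeftInvariant isLeftInvariant_leftMetric
  smooth := by
    have h : ContDiff ℝ ∞ (weight α β z) := by
      unfold weight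
      fun_prop
    exact h.contMDiff
  hess_eq p u v := by
    have h : ∀ u v : Fin 4 → ℝ, innerForm α β z p ((weight α β z p • hessOp α β z) u) v =
        weight α β z p / m * (innerForm α β z p (ricciOp α β z u) v
          - -2 * rho α β * innerForm α β z p u v) := by
      intro u v
      have h1 := congrArg (fun y => innerForm α β z p y v) (smul_hessOp hz u)
      simp only [map_sub, map_smul, sub_apply, smul_apply, smul_eq_mul] at h1
      rw [← h1]
      simp
      field_simp
    refine (hess_leftMetric hβ p u v).trans ((h u v).trans ?_)
    exact congrArg (fun r => weight α β z p / m * (r - -2 * rho α β * innerForm α β z p u v))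
      (ricci_leftMetric hβ p u v).symm
  pos p := Real.exp_pos _
  laplacian_eq h p := by
    subst h
    refine (laplacian_leftMetric hβ p).trans ?_
    linear_combination (weight α β z p * rho α β) * hz

/-- The left invariant metric is not Ricci semisymmetric, hence not rigid. -/
theorem not_isRigid_leftMetric {m : ℝ} (hm : 0 < m) (hβ : β ≠ 0) (hρ : rho α β ≠ 2)
    (hz : z ^ 2 * (m * rho α β + 2 * rho α β - 2) = 2) :
    ¬ (toRiemMfd (leftMetric α β z)).IsRigid := by
  intro hr
  have h0 : Coord.RicciSemisymmetricAt (innerForm α β z) 0 :=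
    (congrArg (fun h => Coord.RicciSemisymmetricAt h 0)
      (coordMetric_leftMetric (0 : Fin 4 → ℝ))).mp (hr.isRicciSemisymmetric (0 : Fin 4 → ℝ))
  have hP : fibreMetric α β z 0 = 1 := by simp [fibreMetric, expMat_zero]
  -- Semisymmetry is tested on `R(X₁, v)` and `w = X₁ + v` with `v = aX₂ + bX₃`. The sum `X₁ + v` is
  -- needed to pick up the cross terms, which compare `Ric` on the fibre with its value on `X₁`. By
  -- Cayley-Hamilton, `(A - ρ) A² = (2 - ρ) (A - (2 - ρ))`, whose quadratic form appears here.
  have key : ∀ a b : ℝ, (1 - z ^ 2 * (rho α β - 1)) * (2 - rho α β) *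
      (α * a ^ 2 + 2 * β * a * b + (2 - α) * b ^ 2 - (2 - rho α β) * (a ^ 2 + b ^ 2)) = 0 := by
    intro a b
    have h := h0 ![0, 1, 0, 0] ![0, 0, a, b] ![0, 1, a, b]
    rw [ricci_innerForm hβ, ricci_innerForm hβ, riemann_innerForm hβ, innerForm_eq, innerForm_eq,
      ricciOp_apply, ricciOp_apply, hP] at h
    simp [christoffelForm, fibreMetricDeriv, action, matF, matA, Matrix.mulVec, dotProduct,
      Fin.sum_univ_two, rho] at h
    rw [rho]
    linear_combination (-1 / 4) * h
  -- Polarization isolates the off-diagonal coefficient, in which the scalar term drops out.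
  have h1 : (1 - z ^ 2 * (rho α β - 1)) * (2 - rho α β) * (2 * β) = 0 := by
    linear_combination key 1 1 - key 1 0 - key 0 1
  -- The condition on `z` writes the first factor as half of `m ρ z²`, which is positive.
  have h2 : m * rho α β * z ^ 2 = 2 * (1 - z ^ 2 * (rho α β - 1)) := by linarith
  have hρ1 := one_lt_rho (α := α) hβ
  have hz0 : z ≠ 0 := by
    rintro rfl
    simp at hz
  have h3 : m * rho α β * z ^ 2 ≠ 0 := by positivity
  have h4 : 1 - z ^ 2 * (rho α β - 1) ≠ 0 := by
    intro h
    rw [h2, h] at h3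
    simp at h3
  simp [h4, hβ, sub_eq_zero, hρ.symm] at h1

end SolvGroup

end

/-! ### The main theorem -/

theorem mainTheorem2 (m α β lam : ℝ) (hm : 0 < m) (hβ : β ≠ 0)
    (hαβ : (α - 1) ^ 2 + β ^ 2 ≠ 1) (hlam : lam = -2 * (2 - 2 * α + α ^ 2 + β ^ 2)) :
    lam < -2 ∧ 0 < -4 / (lam * (m + 2) + 4) ∧
    ∀ z : ℝ, z ^ 2 = -4 / (lam * (m + 2) + 4) →
      -- the group: simply connected, solvable, non-unimodular, with the given brackets
      SimplyConnectedSpace (SolvGroup α β z) ∧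
      Group.IsSolvable (SolvGroup α β z) ∧
      (∃ V : SolvGroup.LieAlg α β z,
        LinearMap.trace ℝ (SolvGroup.LieAlg α β z)
          (LieAlgebra.ad ℝ (SolvGroup.LieAlg α β z) V) ≠ 0) ∧
      (⁅SolvGroup.X α β z 0, SolvGroup.X α β z 1⁆ = 0 ∧
        ⁅SolvGroup.X α β z 0, SolvGroup.X α β z 2⁆ =
          (-(z * (2 - 3 * α + α ^ 2 + β ^ 2))) • SolvGroup.X α β z 2 + (z * β) • SolvGroup.X α β z 3 ∧
        ⁅SolvGroup.X α β z 0, SolvGroup.X α β z 3⁆ =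
          (z * β) • SolvGroup.X α β z 2 + (-(z * (-α + α ^ 2 + β ^ 2))) • SolvGroup.X α β z 3 ∧
        ⁅SolvGroup.X α β z 1, SolvGroup.X α β z 2⁆ =
          α • SolvGroup.X α β z 2 + β • SolvGroup.X α β z 3 ∧
        ⁅SolvGroup.X α β z 1, SolvGroup.X α β z 3⁆ =
          β • SolvGroup.X α β z 2 + (2 - α) • SolvGroup.X α β z 3 ∧
        ⁅SolvGroup.X α β z 2, SolvGroup.X α β z 3⁆ =
          0) ∧
      -- the left invariant metric for which `X₀, X₁, X₂, X₃` is an orthonormal frame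
      ∃ γ : SolvGroup.Metric α β z, SolvGroup.IsLeftInvariant γ ∧
        (∀ (x : SolvGroup α β z) (i j : Fin 4),
          γ.inner x (mulInvariantVectorField (SolvGroup.X α β z i) x)
            (mulInvariantVectorField (SolvGroup.X α β z j) x) = if i = j then 1 else 0) ∧
        (∃ w : SolvGroup α β z → ℝ, (SolvGroup.toRiemMfd γ).IsQuasiEinstein lam m w ∧
          ∀ x, (SolvGroup.toRiemMfd γ).mu lam m w x = 0) ∧
        (∃ c : ℝ, ∀ x, (SolvGroup.toRiemMfd γ).scal x = c) ∧
        ¬ (SolvGroup.toRiemMfd γ).IsRigid := by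
  have hρ := SolvGroup.one_lt_rho (α := α) hβ
  replace hlam : lam = -2 * SolvGroup.rho α β := hlam
  have hneg : lam * (m + 2) + 4 < 0 := by
    rw [hlam]
    nlinarith [mul_pos hm (sub_pos.2 hρ)]
  refine ⟨by linarith, div_pos_of_neg_of_neg (by norm_num) hneg, fun z hz => ?_⟩
  -- The denominator `lam (m + 2) + 4` equals `-2 (mρ + 2ρ - 2)`.
  replace hz : z ^ 2 * (m * SolvGroup.rho α β + 2 * SolvGroup.rho α β - 2) = 2 := by
    rw [eq_div_iff hneg.ne, hlam] at hz
    linear_combination (-1 / 2) * hz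
  -- This is the hypothesis `(α - 1)² + β² ≠ 1`, that is, `det A ≠ 0`.
  have hρ2 : SolvGroup.rho α β ≠ 2 := by
    intro h
    rw [SolvGroup.rho] at h
    exact hαβ (by linarith)
  subst hlam
  have hb : ∀ i j, (⁅SolvGroup.X α β z i, SolvGroup.X α β z j⁆ : SolvGroup.LieAlg α β z) = _ :=
    fun i j => (SolvGroup.bracket_eq _ _).trans (SolvGroup.bracketForm_single i j)
  refine ⟨SolvGroup.simplyConnectedSpace, SolvGroup.isSolvable, ⟨SolvGroup.X α β z 1, ?_⟩,
    ⟨hb 0 1, hb 0 2, hb 0 3, hb 1 2, hb 1 3, hb 2 3⟩, SolvGroup.leftMetric α β z,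
    SolvGroup.isLeftInvariant_leftMetric, SolvGroup.leftMetric_frame,
    ⟨SolvGroup.weight α β z, SolvGroup.isQuasiEinstein_leftMetric hm hβ hz,
      SolvGroup.mu_leftMetric hβ hz⟩,
    ⟨_, SolvGroup.scal_leftMetric hβ⟩, SolvGroup.not_isRigid_leftMetric hm hβ hρ2 hz⟩
  rw [SolvGroup.trace_ad_X_one]
  norm_num
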